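/- An integer matrix $A$ is called $\Delta$-modular if every $\operatorname{rank}(A)\times\operatorname{rank}(A)$ submatrix of $A$ has determinant at most $\Delta$ in absolute value, and a matroid is called $\Delta$-modular if it is isomorphic to the vector matroid $M[A]$ over $\mathbb{R}$ of a $\Delta$-modular integer matrix $A$. Let $\Delta, r \ge 2$ be integers with $r \ge \Delta+1$, and let $N_\Delta$ be the number of integer partitions of $\Delta-1$. Then there are at least $N_\Delta+1$ pairwise non-isomorphic simple, rank-$r$, $\Delta$-modular matroids with exactly $\binom{r+1}{2}+(\Delta-1)(r-1)$ elements. More precisely, let $e_1,\dots,e_r$ be the standard unit vectors of $\mathbb{R}^r$. For a partition $\lambda=(\lambda_1\ge\dots\ge\lambda_m\ge 1)$ of $\Delta-1$, let $A(\Delta,\lambda,r)$ be the matrix with the columns $e_i$ ($1\le i\le r$); $e_i-e_j$ ($1\le i<j\le r$); $k e_1+e_{i+1}$ ($1\le i\le m$, $1\le k\le\lambda_i$); and $k e_1+e_{i+1}-e_j$ ($1\le i\le m$, $1\le k\le\lambda_i$, $j\in\{1,\dots,r\}\setminus\{1,i+1\}$). Let $A(\Delta,r)$ be the matrix with the columns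 $e_i$ ($1\le i\le r$); $e_i-e_j$ ($1\le i<j\le r$); and $k e_1-e_i$ ($2\le i\le r$, $2\le k\le\Delta$). Then the $N_\Delta+1$ vector matroids $M[A(\Delta,r)]$ and $M[A(\Delta,\lambda,r)]$, for $\lambda$ ranging over all partitions of $\Delta-1$, are simple, $\Delta$-modular, of rank $r$, with exactly $\binom{r+1}{2}+(\Delta-1)(r-1)$ elements, and are pairwise non-isomorphic. -/

import Mathlib

namespace DeltaModular

/-- `A` is `Δ`-modular: with `ρ = rank A`, every `ρ × ρ` submatrix of the integer matrix `A` has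
determinant at most `Δ` in absolute value. (Permuting the chosen rows or columns only changes the
sign of the determinant, so arbitrary injections may be used to choose them.) -/
def IsModularMatrix {m n : Type*} [Fintype n] (Δ : ℕ) (A : Matrix m n ℤ) : Prop :=
  ∀ (f : Fin (A.map (Int.cast : ℤ → ℝ)).rank ↪ m) (g : Fin (A.map (Int.cast : ℤ → ℝ)).rank ↪ n),
    |(A.submatrix f g).det| ≤ (Δ : ℤ)

/-- Independent sets of vectors in a real vector space satisfy the augmentation axiom. -/
theorem exists_augment {n V : Type*} [Finite n] [AddCommGroup V] [Module ℝ V] (v : n → V)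
    {I J : Set n} (hI : LinearIndepOn ℝ v I) (hJ : LinearIndepOn ℝ v J)
    (h : I.ncard < J.ncard) : ∃ e ∈ J, e ∉ I ∧ LinearIndepOn ℝ v (insert e I) := by
  classical
  by_contra! hcon
  have hsub : v '' J ⊆ Submodule.span ℝ (v '' I) := by
    rintro _ ⟨e, he, rfl⟩
    by_cases heI : e ∈ I
    · exact Submodule.subset_span ⟨e, heI, rfl⟩
    · by_contra hns
      exact hcon e he heI (hI.insert hns)
  have hle : Submodule.span ℝ (v '' J) ≤ Submodule.span ℝ (v '' I) :=
    Submodule.span_le.2 hsub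
  have key : ∀ {K : Set n}, LinearIndepOn ℝ v K →
      Module.finrank ℝ (Submodule.span ℝ (v '' K)) = K.ncard := by
    intro K hK
    have : Fintype K := Fintype.ofFinite K
    have h1 := finrank_span_eq_card (R := ℝ) (b := fun i : K => v i) hK
    rw [show Set.range (fun i : K => v i) = v '' K by ext; simp] at h1
    rw [h1, ← Nat.card_eq_fintype_card, Nat.card_coe_set_eq]
  have : FiniteDimensional ℝ (Submodule.span ℝ (v '' I)) :=
    FiniteDimensional.span_of_finite ℝ (Set.toFinite _)
  have := Submodule.finrank_mono hle
  rw [key hI, key hJ] at this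
  omega

/-- The vector matroid `M[A]` of an integer matrix: its ground set is the set of all column
indices, and a set of columns is independent if it is linearly independent over `ℝ`. -/
def vectorMatroid {m n : Type*} [Finite n] (A : Matrix m n ℤ) : Matroid n :=
  (IndepMatroid.ofFinite (E := Set.univ) Set.finite_univ
    (fun I => LinearIndepOn ℝ (A.map (Int.cast : ℤ → ℝ)).col I)
    (linearIndepOn_empty ℝ _)
    (fun _ _ hJ hIJ => hJ.mono hIJ)
    (fun _ _ hI hJ h => exists_augment _ hI hJ h)
    (fun _ _ => Set.subset_univ _)).matroid

/-- Matroid isomorphism: a bijection between the ground sets under which a set is independent if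
and only if its image is. -/
def Isomorphic {α β : Type*} (M : Matroid α) (N : Matroid β) : Prop :=
  ∃ e : M.E ≃ N.E, ∀ I : Set M.E,
    M.Indep (Subtype.val '' I) ↔ N.Indep (Subtype.val '' (e '' I))

/-- A matroid is simple if it has no loops (the case `e = f`) and no two distinct parallel
elements. -/
def IsSimple {α : Type*} (M : Matroid α) : Prop :=
  ∀ e ∈ M.E, ∀ f ∈ M.E, M.Indep {e, f}

/-- A matroid is `Δ`-modular if it has a representation over `ℝ` by a `Δ`-modular integer
matrix. -/
def IsModularMatroid {α : Type*} (Δ : ℕ) (M : Matroid α) : Prop :=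
  ∃ (m n : ℕ) (A : Matrix (Fin m) (Fin n) ℤ),
    IsModularMatrix Δ A ∧ Isomorphic M (vectorMatroid A)

/-- Simple, `Δ`-modular, of rank `r`, with exactly `s` elements. -/
structure IsSimpleModular {α : Type*} (Δ r s : ℕ) (M : Matroid α) : Prop where
  simple : IsSimple M
  modular : IsModularMatroid Δ M
  rank_eq : M.eRank = (r : ℕ∞)
  card_eq : M.E.encard = (s : ℕ∞)

/-- The standard unit vectors of `ℤ ^ r`, numbered from `0`: `unitVec r 0` is `e₁`,
`unitVec r 1` is `e₂`, and so on. -/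
def unitVec (r a : ℕ) : Fin r → ℤ := fun x => if (x : ℕ) = a then 1 else 0

/-- Labels of the columns `e_i` and `e_i - e_j`, `i < j`. -/
abbrev CliqueIdx (r : ℕ) : Type := Fin r ⊕ {p : Fin r × Fin r // p.1 < p.2}

/-- The columns `e_i`, and `e_i - e_j` for `i < j`. -/
def cliqueColumn (r : ℕ) : CliqueIdx r → Fin r → ℤ
  | .inl i => unitVec r i
  | .inr p => unitVec r p.1.1 - unitVec r p.1.2

/-- Labels of the additional columns attached to a list `l = (λ₁, …, λₘ)`. The entry `λ_{i+1}` is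
`l.get i`, and `k : Fin (l.get i)` stands for the multiplier `k + 1 ∈ {1, …, λ_{i+1}}`. -/
abbrev PartIdx (l : List ℕ) (r : ℕ) : Type :=
  (Σ i : Fin l.length, Fin (l.get i)) ⊕
    (Σ i : Fin l.length, Fin (l.get i) × {j : Fin r // (j : ℕ) ≠ 0 ∧ (j : ℕ) ≠ i + 1})

/-- The columns `k e₁ + e_{i+1}` and `k e₁ + e_{i+1} - e_j`, where `1 ≤ i ≤ m`, `1 ≤ k ≤ λ_i` and
`j ∉ {1, i + 1}`. -/
def partColumn (l : List ℕ) (r : ℕ) : PartIdx l r → Fin r → ℤ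
  | .inl ⟨i, k⟩ => ((k : ℤ) + 1) • unitVec r 0 + unitVec r (i + 1)
  | .inr ⟨i, k, j⟩ => ((k : ℤ) + 1) • unitVec r 0 + unitVec r (i + 1) - unitVec r j.1

/-- The matrix `A(Δ, λ, r)`, for a partition `λ` of `Δ - 1` written as the non-increasing list
of its parts. It is meant for `r ≥ m + 1`, where `m` is the number of parts. -/
def partMatrix (Δ : ℕ) (p : Nat.Partition (Δ - 1)) (r : ℕ) :
    Matrix (Fin r) (CliqueIdx r ⊕ PartIdx (p.parts.sort (· ≥ ·)) r) ℤ :=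
  Matrix.of fun x c => Sum.elim (cliqueColumn r) (partColumn (p.parts.sort (· ≥ ·)) r) c x

/-- Labels of the columns `k e₁ - e_i` with `2 ≤ i ≤ r` and `2 ≤ k ≤ Δ`; here `k : Fin (Δ - 1)`
stands for the multiplier `k + 2`. -/
abbrev LeeIdx (Δ r : ℕ) : Type := {i : Fin r // (i : ℕ) ≠ 0} × Fin (Δ - 1)

/-- The columns `k e₁ - e_i` with `2 ≤ i ≤ r` and `2 ≤ k ≤ Δ`. -/
def leeColumn (Δ r : ℕ) : LeeIdx Δ r → Fin r → ℤ :=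
  fun c => ((c.2 : ℤ) + 2) • unitVec r 0 - unitVec r c.1.1

/-- The matrix `A(Δ, r)` of Lee, Paat, Stallknecht and Xu. -/
def leeMatrix (Δ r : ℕ) : Matrix (Fin r) (CliqueIdx r ⊕ LeeIdx Δ r) ℤ :=
  Matrix.of fun x c => Sum.elim (cliqueColumn r) (leeColumn Δ r) c x

end DeltaModular

/-! All the matrices belong to one family. Put weights `w` with sum Δ and `w 0 ≥ 1` on the vertices
0, …, r - 1 of a gain graph with a loop at 0, an edge of gain 0 for each pair of vertices, and edges
of gains 1, …, `w t` from `t` to every other vertex; an edge of gain a from t to h has the column a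
e₁ + x_t - x_h. Up to order and signs of columns, A(Δ, r) has weights (Δ, 0, …, 0) and A(Δ, λ, r)
has weights (1, λ₁, …, λₘ, 0, …, 0).

Modularity (`abs_det_gain_le`): expanding along the first row, which holds the gains, writes a
determinant as ∑ a_c C_c. For columns with a common tail v, every partial sum of the C_c is the
determinant of a matrix with a 0/1 first row, which one row operation turns into a network matrix;
so it is -1, 0 or 1. As these gains lie in [0, `w v`], tail v contributes at most `w v`, and the
total is at most Δ.

Non-isomorphism: a line with at least four points consists of the loop and all edges between two
vertices u, v, and has `w u + w v + 2` points (`ncard_linesOfSize_gainMatrix`). Counting lines by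
size thus reveals how often each pair sum ≥ 2 occurs; the number of pairs and the total weight then
settle the sums 0 and 1. Finally, pair sums determine the weights if some weight is 0
(`card_weights_eq`), which r ≥ Δ + 1 ensures: compare the lowest terms of generating polynomials. -/

namespace DeltaModular

/-! ### Determinants of gain graph matrices -/

/-- A square matrix all of whose columns have at most one entry `1`, at most one entry `-1` and no
other nonzero entries has determinant `-1`, `0` or `1`. -/
theorem abs_det_le_one_of_network : ∀ (n : ℕ) (M : Matrix (Fin n) (Fin n) ℤ),
    (∀ c i, |M i c| ≤ 1) → (∀ c i j, M i c = 1 → M j c = 1 → i = j) →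
    (∀ c i j, M i c = -1 → M j c = -1 → i = j) → |M.det| ≤ 1
  | 0, M, _, _, _ => by simp
  | n + 1, M, h, hp, hm => by
    have tri : ∀ c i, M i c = 0 ∨ M i c = 1 ∨ M i c = -1 := by
      intro c i
      have := abs_le.1 (h c i)
      omega
    -- A column lacking 1 or lacking -1 has at most one nonzero entry, and Laplace expansion along
    -- it leaves a smaller matrix of the same kind. Otherwise all columns sum to 0, so the all-ones
    -- vector is in the left kernel.
    by_cases hc : ∃ c, (∀ i, M i c ≠ 1) ∨ (∀ i, M i c ≠ -1)
    · obtain ⟨c, hc⟩ := hc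
      obtain ⟨k, hk⟩ : ∃ k, ∀ i, i ≠ k → M i c = 0 := by
        by_cases hz : ∃ k, M k c ≠ 0
        · obtain ⟨k, hk⟩ := hz
          refine ⟨k, fun i hi => ?_⟩
          by_contra hne
          rcases hc with hc | hc
          · exact hi (hm c i k (by have := tri c i; have := hc i; tauto)
              (by have := tri c k; have := hc k; tauto))
          · exact hi (hp c i k (by have := tri c i; have := hc i; tauto)
              (by have := tri c k; have := hc k; tauto))
        · push Not at hz
          exact ⟨0, fun i _ => hz i⟩
      rw [Matrix.det_succ_column M c, Finset.sum_eq_single k]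
      · have ih := abs_det_le_one_of_network n (M.submatrix k.succAbove c.succAbove)
          (fun _ _ => h _ _)
          (fun _ _ _ h1 h2 => Fin.succAbove_right_injective (hp _ _ _ h1 h2))
          (fun _ _ _ h1 h2 => Fin.succAbove_right_injective (hm _ _ _ h1 h2))
        rw [abs_mul, abs_mul, abs_pow, abs_neg, abs_one, one_pow, one_mul]
        exact mul_le_one₀ (h c k) (abs_nonneg _) ih
      · intro i _ hi
        simp [hk i hi]
      · simp
    · push Not at hc
      have : M.det = 0 := by
        rw [← Matrix.exists_vecMul_eq_zero_iff]
        refine ⟨fun _ => 1, fun h0 => one_ne_zero (congrFun h0 0), ?_⟩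
        ext c
        obtain ⟨⟨i, hi⟩, ⟨j, hj⟩⟩ := hc c
        have hij : i ≠ j := by
          rintro rfl
          omega
        simp only [Matrix.vecMul, dotProduct, one_mul, Pi.zero_apply]
        rw [Finset.sum_eq_add_of_mem i j (Finset.mem_univ _) (Finset.mem_univ _) hij, hi, hj]
        · norm_num
        · intro k _ hk
          rcases tri c k with h0 | h0 | h0
          · exact h0
          · exact absurd (hp c k i h0 hi) hk.1
          · exact absurd (hm c k j h0 hj) hk.2
      simp [this]

/-- The vector `a e₁ + x_t - x_h`, where `x_v = e_{v+1}` for `v ≠ 0` and `x_0 = 0`: the column of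
the edge with gain `a` from the vertex `t` to the vertex `h` in a gain graph on `0, …, r - 1`. -/
def gainVec (r t h a : ℕ) : Fin r → ℤ := fun i =>
  if (i : ℕ) = 0 then (a : ℤ) else (if (i : ℕ) = t then 1 else 0) - (if (i : ℕ) = h then 1 else 0)

/-- Subtracting the indicator row from row `v` cancels the tail entry 1 in the columns of `S`, so
each column keeps at most one 1 and one -1. For `v = 0` the tail has no entry to cancel, since row
`z` was overwritten. -/
theorem abs_det_indicator_le_one {r : ℕ} (z : Fin r) (hz : (z : ℕ) = 0) (t h a : Fin r → ℕ)
    (v : ℕ) (hv : v < r) (S : Finset (Fin r)) (hS : ∀ c ∈ S, t c = v) :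
    |((Matrix.of fun i c => gainVec r (t c) (h c) (a c) i).updateRow z
      (fun c => if c ∈ S then 1 else 0)).det| ≤ 1 := by
  set M := (Matrix.of fun i c => gainVec r (t c) (h c) (a c) i).updateRow z
      (fun c => if c ∈ S then 1 else 0) with hM
  have hMz : ∀ c, M z c = if c ∈ S then 1 else 0 := fun c => by simp [hM]
  have hMi : ∀ i c, i ≠ z → M i c =
      (if (i : ℕ) = t c then 1 else 0) - (if (i : ℕ) = h c then 1 else 0) := by
    intro i c hi
    have : (i : ℕ) ≠ 0 := fun h0 => hi (Fin.ext (h0.trans hz.symm))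
    simp [hM, Matrix.updateRow_ne hi, gainVec, this]
  suffices H : ∃ N : Matrix (Fin r) (Fin r) ℤ, N.det = M.det ∧ ∀ i c, N i c =
      (if i = z then (if c ∈ S then 1 else 0) else
        (if (i : ℕ) = t c ∧ c ∉ S then 1 else 0) - (if (i : ℕ) = h c then 1 else 0)) by
    obtain ⟨N, hN, hNe⟩ := H
    rw [← hN]
    apply abs_det_le_one_of_network
    · intro c i
      rw [hNe]
      split_ifs <;> simp
    · intro c i j
      rw [hNe, hNe]
      intro h1 h2
      apply Fin.ext
      split_ifs at h1 h2 <;> first | omega | simp_all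
    · intro c i j
      rw [hNe, hNe]
      intro h1 h2
      apply Fin.ext
      split_ifs at h1 h2 <;> omega
  by_cases hv0 : v = 0
  · refine ⟨M, rfl, fun i c => ?_⟩
    by_cases hi : i = z
    · rw [hi, hMz]; simp
    · rw [hMi i c hi, if_neg hi]
      have : (i : ℕ) ≠ 0 := fun h0 => hi (Fin.ext (h0.trans hz.symm))
      have := hS c
      congr 2
      simp only [eq_iff_iff]
      constructor
      · intro h1
        exact ⟨h1, fun h2 => by have := this h2; omega⟩
      · exact fun h1 => h1.1
  · have hne : (⟨v, hv⟩ : Fin r) ≠ z := fun h0 => hv0 (by rw [← h0] at hz; exact hz)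
    refine ⟨M.updateRow ⟨v, hv⟩ (M ⟨v, hv⟩ + (-1 : ℤ) • M z),
      Matrix.det_updateRow_add_smul_self M hne (-1), fun i c => ?_⟩
    by_cases hi : i = ⟨v, hv⟩
    · subst hi
      rw [if_neg hne, Matrix.updateRow_self, Pi.add_apply, Pi.smul_apply, hMi _ c hne, hMz]
      have := hS c
      by_cases hc : c ∈ S
      · simp only [this hc, hc, if_true, not_true_eq_false, and_false, if_false, smul_eq_mul]
        ring
      · simp [hc]
    · rw [Matrix.updateRow_ne hi]
      by_cases hiz : i = z
      · rw [hiz, hMz]; simp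
      · rw [hMi i c hiz, if_neg hiz]
        have h3 : (i : ℕ) ≠ v := fun h0 => hi (Fin.ext h0)
        have := hS c
        congr 2
        simp only [eq_iff_iff]
        constructor
        · intro h1
          exact ⟨h1, fun h2 => by have := this h2; omega⟩
        · exact fun h1 => h1.1

/-- If all partial sums of the integers `C c`, `c ∈ T`, have absolute value at most `1`, then
weighted sums with weights in `[0, w]` have absolute value at most `w`. -/
theorem abs_weighted_sum_le {ι : Type*} (T : Finset ι) (C a : ι → ℤ) (w : ℤ)
    (hw : 0 ≤ w) (ha0 : ∀ c ∈ T, 0 ≤ a c) (haw : ∀ c ∈ T, a c ≤ w)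
    (hC : ∀ S ⊆ T, |∑ c ∈ S, C c| ≤ 1) : |∑ c ∈ T, a c * C c| ≤ w := by
  classical
  have upper : ∀ D : ι → ℤ, (∀ S ⊆ T, ∑ c ∈ S, D c ≤ 1) → ∑ c ∈ T, a c * D c ≤ w := by
    intro D hD
    -- Dropping the negative terms and raising the other weights to `w` leaves `w` times a single
    -- partial sum.
    calc ∑ c ∈ T, a c * D c ≤ ∑ c ∈ T, (if 0 ≤ D c then w * D c else 0) := by
          apply Finset.sum_le_sum
          intro c hc
          split_ifs with h
          · exact mul_le_mul_of_nonneg_right (haw c hc) h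
          · exact mul_nonpos_of_nonneg_of_nonpos (ha0 c hc) (by omega)
      _ = w * ∑ c ∈ T with 0 ≤ D c, D c := by
          rw [← Finset.sum_filter, Finset.mul_sum]
      _ ≤ w * 1 := mul_le_mul_of_nonneg_left (hD _ (Finset.filter_subset _ _)) hw
      _ = w := mul_one w
  rw [abs_le]
  constructor
  · have := upper (fun c => -C c) (fun S hS => by
      have := abs_le.1 (hC S hS)
      rw [Finset.sum_neg_distrib]; omega)
    simp only [mul_neg, Finset.sum_neg_distrib] at this
    omega
  · exact upper C (fun S hS => (abs_le.1 (hC S hS)).2)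

theorem abs_det_gain_le {r : ℕ} (z : Fin r) (hz : (z : ℕ) = 0) (w : ℕ → ℕ) (t h a : Fin r → ℕ)
    (ht : ∀ c, t c < r) (ha : ∀ c, a c ≤ w (t c)) :
    |(Matrix.of fun i c => gainVec r (t c) (h c) (a c) i).det| ≤
      ∑ v ∈ Finset.range r, (w v : ℤ) := by
  set M : Matrix (Fin r) (Fin r) ℤ := Matrix.of fun i c => gainVec r (t c) (h c) (a c) i with hM
  set C : Fin r → ℤ := fun c => M.transpose.cramer (Pi.single c 1) z with hC
  -- The `C c` are the cofactors of row `z`, unaffected by replacing that row.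
  have expand : ∀ b : Fin r → ℤ, (M.updateRow z b).det = ∑ c, b c * C c := by
    intro b
    rw [← Matrix.cramer_transpose_apply]
    conv_lhs => rw [← Finset.univ_sum_single b]
    rw [map_sum, Finset.sum_apply]
    refine Finset.sum_congr rfl fun c _ => ?_
    rw [show (Pi.single c (b c) : Fin r → ℤ) = b c • Pi.single c 1 by
      rw [← Pi.single_smul]; simp, map_smul]
    simp [hC]
  have hdet : M.det = ∑ c, (a c : ℤ) * C c := by
    rw [← expand, show (fun c => (a c : ℤ)) = M z by ext c; simp [hM, gainVec, hz],
      Matrix.updateRow_eq_self]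
  have hind : ∀ v < r, ∀ S ⊆ Finset.univ.filter (fun c => t c = v), |∑ c ∈ S, C c| ≤ 1 := by
    intro v hv S hS
    have := abs_det_indicator_le_one z hz t h a v hv S
      (fun c hc => (Finset.mem_filter.1 (hS hc)).2)
    rw [← hM, expand] at this
    simpa using this
  rw [hdet, ← Finset.sum_fiberwise_of_maps_to (s := Finset.univ) (t := Finset.range r) (g := t)
    (fun c _ => Finset.mem_range.2 (ht c))]
  refine (Finset.abs_sum_le_sum_abs _ _).trans (Finset.sum_le_sum fun v hv => ?_)
  refine abs_weighted_sum_le _ C _ _ (by positivity) (fun _ _ => by positivity) (fun c hc => ?_)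
    (hind v (Finset.mem_range.1 hv))
  have := ha c
  rw [(Finset.mem_filter.1 hc).2] at this
  exact_mod_cast this

/-! ### Vector matroids and isomorphisms -/

theorem vectorMatroid_ground {m n : Type*} [Finite n] (A : Matrix m n ℤ) :
    (vectorMatroid A).E = Set.univ := rfl

theorem vectorMatroid_indep_iff {m n : Type*} [Finite n] (A : Matrix m n ℤ) (I : Set n) :
    (vectorMatroid A).Indep I ↔ LinearIndepOn ℝ (A.map (Int.cast : ℤ → ℝ)).col I := by
  simp [vectorMatroid]

theorem Isomorphic.symm {α β : Type*} {M : Matroid α} {N : Matroid β} (h : Isomorphic M N) :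
    Isomorphic N M := by
  obtain ⟨e, he⟩ := h
  refine ⟨e.symm, fun I => ?_⟩
  rw [he (e.symm '' I), Equiv.image_symm_eq_preimage, Set.image_preimage_eq _ e.surjective]

theorem Isomorphic.trans {α β γ : Type*} {M : Matroid α} {N : Matroid β} {P : Matroid γ}
    (h : Isomorphic M N) (h' : Isomorphic N P) : Isomorphic M P := by
  obtain ⟨e, he⟩ := h
  obtain ⟨f, hf⟩ := h'
  refine ⟨e.trans f, fun I => ?_⟩
  rw [he I, hf, Set.image_image f e]
  rfl

theorem Isomorphic.exists_equiv {α β : Type*} {M : Matroid α} {N : Matroid β}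
    (h : Isomorphic M N) (hM : M.E = Set.univ) (hN : N.E = Set.univ) :
    ∃ e : α ≃ β, ∀ I : Set α, M.Indep I ↔ N.Indep (e '' I) := by
  obtain ⟨e, he⟩ := h
  refine ⟨((Equiv.Set.univ α).symm.trans (Equiv.setCongr hM.symm)).trans
    (e.trans ((Equiv.setCongr hN).trans (Equiv.Set.univ β))), fun I => ?_⟩
  have := he (Subtype.val ⁻¹' I)
  rw [Subtype.image_preimage_coe, Set.inter_eq_right.2 (hM ▸ Set.subset_univ I)] at this
  rw [this]
  apply iff_of_eq
  congr 1
  ext b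
  constructor
  · rintro ⟨_, ⟨a, ha, rfl⟩, rfl⟩
    exact ⟨a, ha, rfl⟩
  · rintro ⟨a, ha, rfl⟩
    exact ⟨_, ⟨⟨a, hM ▸ Set.mem_univ a⟩, ha, rfl⟩, rfl⟩

theorem isomorphic_of_equiv {α β : Type*} {M : Matroid α} {N : Matroid β}
    (hM : M.E = Set.univ) (hN : N.E = Set.univ) (e : α ≃ β)
    (he : ∀ I : Set α, M.Indep I ↔ N.Indep (e '' I)) : Isomorphic M N := by
  refine ⟨((Equiv.setCongr hM).trans (Equiv.Set.univ α)).trans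
    (e.trans ((Equiv.Set.univ β).symm.trans (Equiv.setCongr hN.symm))), fun I => ?_⟩
  rw [he, Set.image_image, Set.image_image]
  rfl

/-- Relabelling columns and changing their signs does not change the vector matroid. -/
theorem isomorphic_of_columns {m n n' : Type*} [Finite n] [Finite n'] (A : Matrix m n ℤ)
    (B : Matrix m n' ℤ) (e : n ≃ n')
    (h : ∀ c, (∀ x, B x (e c) = A x c) ∨ (∀ x, B x (e c) = -A x c)) :
    Isomorphic (vectorMatroid A) (vectorMatroid B) := by
  classical
  refine isomorphic_of_equiv rfl rfl e fun I => ?_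
  rw [vectorMatroid_indep_iff, vectorMatroid_indep_iff]
  have hu : ∃ u : n → ℝˣ, (fun c => u c • (A.map (Int.cast : ℤ → ℝ)).col c) =
      (B.map (Int.cast : ℤ → ℝ)).col ∘ e := by
    refine ⟨fun c => if ∀ x, B x (e c) = A x c then 1 else -1, ?_⟩
    ext c x
    dsimp only
    split_ifs with hc
    · simp [Matrix.col_apply, hc]
    · have := (h c).resolve_left hc
      simp [Matrix.col_apply, this]
  obtain ⟨u, hu⟩ := hu
  rw [LinearIndepOn, ← LinearIndependent.units_smul_iff (w := fun i : I => u i)]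
  have h2 : LinearIndepOn ℝ ((B.map (Int.cast : ℤ → ℝ)).col ∘ e) I ↔
      LinearIndepOn ℝ (B.map (Int.cast : ℤ → ℝ)).col (e '' I) :=
    linearIndepOn_equiv e
  rw [← h2, ← hu]
  rfl

theorem Isomorphic.eRank_le {α β : Type*} {M : Matroid α} {N : Matroid β}
    (h : Isomorphic M N) : M.eRank ≤ N.eRank := by
  obtain ⟨e, he⟩ := h
  obtain ⟨B, hB⟩ := M.exists_isBase
  have h1 := he (Subtype.val ⁻¹' B)
  rw [Subtype.image_preimage_coe, Set.inter_eq_right.2 hB.subset_ground] at h1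
  have h2 := (h1.1 hB.indep).encard_le_eRank
  rw [Subtype.val_injective.encard_image, e.injective.encard_image,
    ← Subtype.val_injective.encard_image, Subtype.image_preimage_coe,
    Set.inter_eq_right.2 hB.subset_ground, hB.encard_eq_eRank] at h2
  exact h2

theorem IsSimpleModular.of_isomorphic {α β : Type*} {M : Matroid α} {N : Matroid β} {Δ r s : ℕ}
    (hN : IsSimpleModular Δ r s N) (h : Isomorphic M N) : IsSimpleModular Δ r s M := by
  refine ⟨?_, ?_, ?_, ?_⟩
  · obtain ⟨e, he⟩ := h
    intro a ha b hb
    have := (he {⟨a, ha⟩, ⟨b, hb⟩}).2 (by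
      rw [Set.image_pair, Set.image_pair]
      exact hN.simple _ (e _).2 _ (e _).2)
    rwa [Set.image_pair] at this
  · obtain ⟨m, n, A, hA, hi⟩ := hN.modular
    exact ⟨m, n, A, hA, h.trans hi⟩
  · rw [← hN.rank_eq]
    exact le_antisymm h.eRank_le h.symm.eRank_le
  · rw [← hN.card_eq]
    obtain ⟨e, -⟩ := h
    exact Set.encard_congr e

/-! ### Line sizes as an isomorphism invariant -/

/-- The line through two elements of a simple matroid. -/
def lineThrough {α : Type*} (M : Matroid α) (a b : α) : Set α :=
  {x | x = a ∨ x = b ∨ ¬ M.Indep {a, b, x}}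

/-- The lines with exactly `s` elements. -/
def linesOfSize {α : Type*} (M : Matroid α) (s : ℕ) : Set (Set α) :=
  {L | (∃ a b, a ≠ b ∧ L = lineThrough M a b) ∧ L.ncard = s}

theorem image_linesOfSize_subset {α β : Type*} {M : Matroid α} {N : Matroid β} (e : α ≃ β)
    (he : ∀ I : Set α, M.Indep I ↔ N.Indep (e '' I)) (s : ℕ) :
    Set.image e '' linesOfSize M s ⊆ linesOfSize N s := by
  rintro _ ⟨_, ⟨⟨a, b, hab, rfl⟩, hs⟩, rfl⟩
  refine ⟨⟨e a, e b, e.injective.ne hab, ?_⟩, ?_⟩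
  · ext y
    obtain ⟨x, rfl⟩ := e.surjective y
    rw [e.injective.mem_set_image]
    have := he {a, b, x}
    rw [Set.image_insert_eq, Set.image_pair] at this
    simp [lineThrough, this]
  · rw [Set.ncard_image_of_injective _ e.injective, hs]

theorem ncard_linesOfSize_le {α β : Type*} [Finite β] {M : Matroid α} {N : Matroid β}
    (e : α ≃ β) (he : ∀ I : Set α, M.Indep I ↔ N.Indep (e '' I)) (s : ℕ) :
    (linesOfSize M s).ncard ≤ (linesOfSize N s).ncard := by
  rw [← Set.ncard_image_of_injective (linesOfSize M s) (Set.image_injective.2 e.injective)]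
  exact Set.ncard_le_ncard (image_linesOfSize_subset e he s) (Set.toFinite _)

theorem Isomorphic.ncard_linesOfSize {α β : Type*} [Finite α] [Finite β] {M : Matroid α}
    {N : Matroid β} (h : Isomorphic M N) (hM : M.E = Set.univ) (hN : N.E = Set.univ) (s : ℕ) :
    (linesOfSize M s).ncard = (linesOfSize N s).ncard := by
  obtain ⟨e, he⟩ := h.exists_equiv hM hN
  obtain ⟨f, hf⟩ := h.symm.exists_equiv hN hM
  exact le_antisymm (ncard_linesOfSize_le e he s) (ncard_linesOfSize_le f hf s)

theorem eRank_vectorMatroid {n : Type*} [Finite n] {r : ℕ} (A : Matrix (Fin r) n ℤ)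
    (h : Submodule.span ℝ (Set.range (A.map (Int.cast : ℤ → ℝ)).col) = ⊤) :
    (vectorMatroid A).eRank = r := by
  obtain ⟨B, hB⟩ := (vectorMatroid A).exists_isBase
  rw [← hB.encard_eq_eRank]
  have hi := (vectorMatroid_indep_iff A B).1 hB.indep
  have hspan : Submodule.span ℝ ((A.map (Int.cast : ℤ → ℝ)).col '' B) = ⊤ := by
    rw [eq_top_iff, ← h, Submodule.span_le]
    rintro _ ⟨c, rfl⟩
    by_contra hc
    have h1 := (vectorMatroid_indep_iff A _).2 (hi.insert hc)
    have h2 := hB.eq_of_subset_indep h1 (Set.subset_insert _ _)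
    exact hc (Submodule.subset_span ⟨c, h2 ▸ Set.mem_insert _ _, rfl⟩)
  have : Fintype B := Fintype.ofFinite B
  have h3 := finrank_span_eq_card hi
  rw [show Set.range (fun i : B => (A.map (Int.cast : ℤ → ℝ)).col i) =
    (A.map (Int.cast : ℤ → ℝ)).col '' B by ext; simp, hspan, finrank_top,
    Module.finrank_fin_fun] at h3
  rw [Set.encard_eq_coe_toFinset_card, Set.toFinset_card, ← h3]

/-! ### Gain graphs: edges, columns and coordinates -/

/-- The edges of the gain graph on the vertices `0, …, r - 1` attached to the vertex weights `w`:
the loop at `0` with gain `1`, the edges with gain `0` between any two vertices, and the edges with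
the gains `1, …, w t` that leave the vertex `t`. -/
@[ext] structure GainEdge (r : ℕ) (w : ℕ → ℕ) where
  tail : ℕ
  head : ℕ
  gain : ℕ
  tail_lt : tail < r
  head_lt : head < r
  valid : (tail ≠ head ∧ 1 ≤ gain ∧ gain ≤ w tail) ∨ (tail < head ∧ gain = 0) ∨
    (tail = 0 ∧ head = 0 ∧ gain = 1)

namespace GainEdge

variable {r : ℕ} {w : ℕ → ℕ}

theorem gain_le (e : GainEdge r w) : e.gain ≤ w e.tail + 1 := by
  have := e.valid
  omega

instance : Finite (GainEdge r w) := by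
  have hb : ∀ e : GainEdge r w, e.gain < ∑ v ∈ Finset.range r, w v + 2 := fun e => by
    have h1 := Finset.single_le_sum (f := w) (fun _ _ => Nat.zero_le _)
      (Finset.mem_range.2 e.tail_lt)
    have := e.gain_le
    omega
  refine Finite.of_injective (β := Fin r × Fin r × Fin (∑ v ∈ Finset.range r, w v + 2))
    (fun e => (⟨e.tail, e.tail_lt⟩, ⟨e.head, e.head_lt⟩, ⟨e.gain, hb e⟩)) fun e f h => ?_
  simp only [Prod.mk.injEq, Fin.mk.injEq] at h
  exact GainEdge.ext h.1 h.2.1 h.2.2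

/-- The edges, sorted by kind. -/
def ofSum (hr : 0 < r) : Unit ⊕ {p : Fin r × Fin r // p.1 < p.2} ⊕
    (Σ t : Fin r, {h : Fin r // h ≠ t} × Fin (w t)) → GainEdge r w
  | .inl _ => ⟨0, 0, 1, hr, hr, by omega⟩
  | .inr (.inl p) => ⟨p.1.1, p.1.2, 0, p.1.1.2, p.1.2.2, by have := p.2; omega⟩
  | .inr (.inr ⟨t, h, a⟩) => ⟨t, h.1, a + 1, t.2, h.1.2, by
      have := a.2
      have := Fin.val_ne_of_ne h.2
      omega⟩

theorem ofSum_bijective (hr : 0 < r) : Function.Bijective (ofSum (w := w) hr) := by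
  constructor
  · rintro (_ | ⟨⟨p, p'⟩, hp⟩ | ⟨t, ⟨h, hh⟩, a⟩) (_ | ⟨⟨q, q'⟩, hq⟩ | ⟨t', ⟨h', hh'⟩, a'⟩) heq <;>
      simp only [ofSum, GainEdge.mk.injEq] at heq
    · rfl
    · omega
    · exact absurd (heq.1.symm.trans heq.2.1) (fun h0 => hh' (Fin.ext h0.symm))
    · omega
    · obtain ⟨h1, h2, -⟩ := heq
      obtain rfl := Fin.ext h1
      obtain rfl := Fin.ext h2
      rfl
    · omega
    · exact absurd (heq.1.trans heq.2.1.symm) (fun h0 => hh (Fin.ext h0.symm))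
    · omega
    · obtain ⟨h1, h2, h3⟩ := heq
      obtain rfl := Fin.ext h1
      obtain rfl := Fin.ext h2
      obtain rfl := Fin.ext (Nat.succ_injective h3)
      rfl
  · rintro ⟨t, h, a, ht, hh, hv⟩
    rcases hv with ⟨h1, h2, h3⟩ | ⟨h1, rfl⟩ | ⟨rfl, rfl, rfl⟩
    · refine ⟨.inr (.inr ⟨⟨t, ht⟩, ⟨⟨h, hh⟩, ?_⟩, ⟨a - 1, ?_⟩⟩), ?_⟩
      · intro h0
        exact h1 (Fin.mk.inj h0).symm
      · dsimp only
        omega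
      · ext <;> simp [ofSum]
        omega
    · exact ⟨.inr (.inl ⟨(⟨t, ht⟩, ⟨h, hh⟩), h1⟩), rfl⟩
    · exact ⟨.inl (), rfl⟩

theorem card_pairs (r : ℕ) : Fintype.card {p : Fin r × Fin r // p.1 < p.2} = r.choose 2 := by
  rw [Fintype.card_subtype, Finset.card_filter, Fintype.sum_prod_type_right]
  simp only [← Finset.card_filter]
  rw [Nat.choose_two_right, ← Finset.sum_range_id, ← Fin.sum_univ_eq_sum_range (fun i => i)]
  refine Finset.sum_congr rfl fun v _ => ?_
  rw [Finset.filter_gt_eq_Iio, Fin.card_Iio]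

theorem card_eq (hr : 0 < r) : Nat.card (GainEdge r w) =
    1 + (r.choose 2 + (r - 1) * ∑ v ∈ Finset.range r, w v) := by
  rw [← Nat.card_eq_of_bijective _ (ofSum_bijective hr), Nat.card_eq_fintype_card]
  simp only [Fintype.card_sum, Fintype.card_unit, card_pairs, Fintype.card_sigma,
    Fintype.card_prod, Fintype.card_fin, Fintype.card_subtype_compl, Fintype.card_subtype_eq,
    ← Finset.mul_sum]
  rw [Fin.sum_univ_eq_sum_range w r]

end GainEdge

/-- The matrix whose columns are the vectors of the edges of a gain graph. -/
def gainMatrix (r : ℕ) (w : ℕ → ℕ) : Matrix (Fin r) (GainEdge r w) ℤ :=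
  Matrix.of fun i e => gainVec r e.tail e.head e.gain i

/-- `gainVec` over the real numbers. -/
def gainVecReal (r t h a : ℕ) : Fin r → ℝ := fun i => (gainVec r t h a i : ℝ)

theorem gainMatrix_col (r : ℕ) (w : ℕ → ℕ) (e : GainEdge r w) :
    ((gainMatrix r w).map (Int.cast : ℤ → ℝ)).col e = gainVecReal r e.tail e.head e.gain := rfl

theorem gainVecReal_zero {r t h a : ℕ} (hr : 0 < r) : gainVecReal r t h a ⟨0, hr⟩ = a := by
  simp [gainVecReal, gainVec]

/-- The coordinate of a vector at a vertex, where the coordinate at `0` is chosen so that all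
coordinates of the vector of an edge add up to `0`. -/
noncomputable def vertexCoord (r : ℕ) (v : Fin r) : (Fin r → ℝ) →ₗ[ℝ] ℝ :=
  if (v : ℕ) = 0 then -∑ i ∈ Finset.univ.filter (fun i : Fin r => (i : ℕ) ≠ 0), LinearMap.proj i
  else LinearMap.proj v

/-- These coordinates forget the gain and treat vertex 0 like every other vertex, so arguments about
endpoints need no special case. -/
theorem vertexCoord_gainVecReal {r t h : ℕ} (a : ℕ) (ht : t < r) (hh : h < r) (v : ℕ)
    (hv : v < r) : vertexCoord r ⟨v, hv⟩ (gainVecReal r t h a) =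
      (if v = t then 1 else 0) - (if v = h then 1 else 0) := by
  unfold vertexCoord
  dsimp only
  by_cases h0 : v = 0
  · rw [if_pos h0]
    subst h0
    have key : ∀ s, s < r →
        ∑ i ∈ Finset.univ.filter (fun i : Fin r => (i : ℕ) ≠ 0), (if (i : ℕ) = s then (1 : ℝ) else 0) =
        1 - if 0 = s then 1 else 0 := by
      intro s hs
      rw [Finset.sum_filter, Finset.sum_eq_single ⟨s, hs⟩]
      · by_cases hs0 : s = 0
        · simp [hs0]
        · simp [hs0, Ne.symm hs0]
      · intro b _ hb
        rw [if_neg (fun h1 => hb (Fin.ext h1)), ite_self]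
      · simp
    have : ∑ i ∈ Finset.univ.filter (fun i : Fin r => (i : ℕ) ≠ 0),
        gainVecReal r t h a i =
        ∑ i ∈ Finset.univ.filter (fun i : Fin r => (i : ℕ) ≠ 0),
          ((if (i : ℕ) = t then (1 : ℝ) else 0) - if (i : ℕ) = h then 1 else 0) := by
      refine Finset.sum_congr rfl fun i hi => ?_
      simp [gainVecReal, gainVec, (Finset.mem_filter.1 hi).2]
    simp only [LinearMap.neg_apply, LinearMap.sum_apply, LinearMap.proj_apply]
    rw [this, Finset.sum_sub_distrib, key t ht, key h hh]
    ring
  · rw [if_neg h0]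
    simp [gainVecReal, gainVec, h0]

/-! ### Simplicity, rank and modularity -/

section Pairs

variable {r : ℕ} {w : ℕ → ℕ}

/-- An endpoint belonging to only one of two non-loop edges kills that edge's coefficient. If the
endpoints agree, the gains decide: parallel edges have distinct gains, and opposite edges cannot
both have gain 0, as such edges point to the larger vertex. The loop has zero vertex coordinates and
is handled by the first entry. -/
theorem gainVecReal_pair_indep {a b : GainEdge r w} (hab : a ≠ b) {c d : ℝ}
    (h : c • gainVecReal r a.tail a.head a.gain + d • gainVecReal r b.tail b.head b.gain = 0) :
    c = 0 ∧ d = 0 := by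
  obtain ⟨ta, ha, ga, hta, hha, va⟩ := a
  obtain ⟨tb, hb, gb, htb, hhb, vb⟩ := b
  rw [ne_eq, GainEdge.mk.injEq] at hab
  dsimp only at h
  have H : ∀ v, v < r → c * ((if v = ta then 1 else 0) - (if v = ha then 1 else 0)) +
      d * ((if v = tb then 1 else 0) - (if v = hb then 1 else 0)) = 0 := by
    intro v hv
    have := congrArg (vertexCoord r ⟨v, hv⟩) h
    rw [map_add, map_smul, map_smul, vertexCoord_gainVecReal _ hta hha,
      vertexCoord_gainVecReal _ htb hhb, map_zero] at this
    simpa using this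
  have hr : 0 < r := by omega
  have G : c * (ga : ℝ) + d * gb = 0 := by
    have := congrFun h ⟨0, hr⟩
    simpa [gainVecReal_zero] using this
  have H1 := H ta hta
  have H2 := H ha hha
  have H3 := H tb htb
  have H4 := H hb hhb
  by_cases h1 : ta = ha
  · have : ga = 1 := by omega
    subst h1 this
    have h2 : tb ≠ hb := by omega
    have : d = 0 := by simpa [h2] using H3
    subst this
    simpa using G
  by_cases h2 : tb = hb
  · have : gb = 1 := by omega
    subst h2 this
    have : c = 0 := by simpa [h1] using H1
    subst this
    simpa using G
  by_cases h3 : ta = tb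
  · subst h3
    by_cases h4 : ha = hb
    · subst h4
      have h5 : c = -d := by
        simp [h1] at H1
        linarith
      have h6 : (ga : ℝ) ≠ gb := by
        norm_cast
        tauto
      have : d * ((gb : ℝ) - ga) = 0 := by rw [h5] at G; linarith
      have : d = 0 := by
        rcases mul_eq_zero.1 this with h | h
        · exact h
        · exact absurd (sub_eq_zero.1 h).symm h6
      simp [h5, this]
    · have hc : c = 0 := by simpa [Ne.symm h1, h4] using H2
      have hd : d = 0 := by simpa [Ne.symm h2, Ne.symm h4] using H4
      exact ⟨hc, hd⟩
  · by_cases h4 : ha = hb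
    · subst h4
      have hc : c = 0 := by simpa [h1, h3] using H1
      have hd : d = 0 := by simpa [h2, Ne.symm h3] using H3
      exact ⟨hc, hd⟩
    · by_cases h5 : ta = hb
      · subst h5
        by_cases h6 : tb = ha
        · subst h6
          have h7 : c = d := by
            simp [h1] at H1
            linarith
          subst h7
          have h8 : (ga : ℝ) + gb ≠ 0 := by
            norm_cast
            omega
          have : c * ((ga : ℝ) + gb) = 0 := by linarith
          have := (mul_eq_zero.1 this).resolve_right h8
          exact ⟨this, this⟩
        · have hd : d = 0 := by simpa [h2, h6] using H3
          subst hd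
          have hc : c = 0 := by simpa [h1] using H1
          exact ⟨hc, rfl⟩
      · have hc : c = 0 := by simpa [h1, h3, h5] using H1
        subst hc
        have hd : d = 0 := by simpa [h2] using H3
        exact ⟨rfl, hd⟩

theorem gainMatrix_indep_pair (a b : GainEdge r w) :
    (vectorMatroid (gainMatrix r w)).Indep {a, b} := by
  rw [vectorMatroid_indep_iff]
  by_cases hab : a = b
  · subst hab
    rw [Set.pair_eq_singleton]
    refine LinearIndepOn.singleton fun h0 => ?_
    rw [gainMatrix_col] at h0
    obtain ⟨t, h, g, ht, hh, v⟩ := a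
    dsimp only at h0
    by_cases hth : t = h
    · have h2 := congrFun h0 ⟨0, by omega⟩
      rw [gainVecReal_zero] at h2
      have : g = 1 := by omega
      simp [this] at h2
    · have h2 := congrArg (vertexCoord r ⟨t, ht⟩) h0
      rw [vertexCoord_gainVecReal _ ht hh] at h2
      simp [hth] at h2
  · rw [LinearIndepOn.pair_iff _ hab]
    intro c d h
    exact gainVecReal_pair_indep hab h

theorem isSimple_gainMatrix : IsSimple (vectorMatroid (gainMatrix r w)) :=
  fun a _ b _ => gainMatrix_indep_pair a b

end Pairs

theorem span_gainMatrix (r : ℕ) (w : ℕ → ℕ) :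
    Submodule.span ℝ (Set.range ((gainMatrix r w).map (Int.cast : ℤ → ℝ)).col) = ⊤ := by
  rw [eq_top_iff, ← (Pi.basisFun ℝ (Fin r)).span_eq, Submodule.span_le]
  rintro _ ⟨i, rfl⟩
  have hr : 0 < r := by have := i.2; omega
  by_cases hi : (i : ℕ) = 0
  · refine Submodule.subset_span ⟨⟨0, 0, 1, hr, hr, by omega⟩, ?_⟩
    rw [gainMatrix_col]
    ext x
    have : x = i ↔ (x : ℕ) = 0 := by rw [Fin.ext_iff, hi]
    simp [gainVecReal, gainVec, Pi.single_apply, this]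
  · rw [SetLike.mem_coe, ← neg_mem_iff]
    refine Submodule.subset_span ⟨⟨0, i, 0, hr, i.2, by omega⟩, ?_⟩
    rw [gainMatrix_col]
    ext x
    by_cases hx : (x : ℕ) = 0
    · have : x ≠ i := by rintro rfl; exact hi hx
      simp [gainVecReal, gainVec, hx, this]
    · simp [gainVecReal, gainVec, hx, Pi.single_apply, Fin.ext_iff]

/-- At full row rank the choice of rows is a permutation, which can be absorbed into the choice of
columns. -/
theorem isModularMatrix_of_rank_eq {r n Δ : ℕ} (A : Matrix (Fin r) (Fin n) ℤ)
    (hA : (A.map (Int.cast : ℤ → ℝ)).rank = r)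
    (h : ∀ g : Fin r → Fin n, |(A.submatrix id g).det| ≤ (Δ : ℤ)) : IsModularMatrix Δ A := by
  unfold IsModularMatrix
  rw [hA]
  intro f g
  let e := Equiv.ofBijective f (Finite.injective_iff_bijective.1 f.injective)
  have h1 : A.submatrix f g = (A.submatrix id (g ∘ e.symm)).submatrix e e := by
    ext i j
    simp [e]
  rw [h1, Matrix.det_submatrix_equiv_self]
  exact h _

theorem isModularMatroid_gainMatrix {r Δ : ℕ} (hr : 0 < r) (w : ℕ → ℕ) (h0 : 1 ≤ w 0)
    (hw : ∑ v ∈ Finset.range r, w v = Δ) :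
    IsModularMatroid Δ (vectorMatroid (gainMatrix r w)) := by
  let e := Finite.equivFin (GainEdge r w)
  let A := (gainMatrix r w).submatrix id e.symm
  refine ⟨r, _, A, isModularMatrix_of_rank_eq A ?_ fun g => ?_,
    isomorphic_of_columns _ _ e fun c => Or.inl fun x => by simp [A]⟩
  · rw [Matrix.rank_eq_finrank_span_cols]
    have : Set.range (A.map (Int.cast : ℤ → ℝ)).col =
        Set.range ((gainMatrix r w).map (Int.cast : ℤ → ℝ)).col :=
      e.symm.surjective.range_comp ((gainMatrix r w).map (Int.cast : ℤ → ℝ)).col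
    rw [this, span_gainMatrix, finrank_top, Module.finrank_fin_fun]
  · have := abs_det_gain_le ⟨0, hr⟩ rfl w (fun c => (e.symm (g c)).tail)
      (fun c => (e.symm (g c)).head) (fun c => (e.symm (g c)).gain)
      (fun c => (e.symm (g c)).tail_lt) (fun c => by
        rcases (e.symm (g c)).valid with h | h | h
        · exact h.2.2
        · omega
        -- The loop has gain 1 at tail 0, hence the requirement `1 ≤ w 0`.
        · rw [h.2.2, h.1]
          exact h0)
    rw [← hw]
    push_cast
    exact this

theorem isSimpleModular_gainMatrix {r Δ : ℕ} (hr : 0 < r) (w : ℕ → ℕ) (h0 : 1 ≤ w 0)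
    (hw : ∑ v ∈ Finset.range r, w v = Δ) :
    IsSimpleModular Δ r ((r + 1).choose 2 + (Δ - 1) * (r - 1))
      (vectorMatroid (gainMatrix r w)) := by
  refine ⟨isSimple_gainMatrix, isModularMatroid_gainMatrix hr w h0 hw,
    eRank_vectorMatroid _ (span_gainMatrix r w), ?_⟩
  rw [vectorMatroid_ground, Set.encard_univ, ENat.card_eq_coe_natCard, GainEdge.card_eq hr, hw]
  have hΔ : 1 ≤ Δ := by
    rw [← hw]
    exact h0.trans (Finset.single_le_sum (f := w) (fun _ _ => Nat.zero_le _)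
      (Finset.mem_range.2 hr))
  obtain ⟨D, rfl⟩ := Nat.exists_eq_add_of_le' hΔ
  obtain ⟨s, rfl⟩ := Nat.exists_eq_add_of_le' hr
  norm_cast
  rw [Nat.choose_succ_succ' (s + 1) 1, Nat.choose_one_right]
  simp only [Nat.add_sub_cancel]
  ring

/-! ### Long lines of the gain graph matroid -/

section Lines

variable {r : ℕ} {w : ℕ → ℕ}

/-- The loop at `0` together with all edges between `u` and `v`. -/
def pencil (r : ℕ) (w : ℕ → ℕ) (u v : ℕ) : Set (GainEdge r w) :=
  {e | e.tail = e.head ∨ (e.tail = u ∧ e.head = v) ∨ (e.tail = v ∧ e.head = u)}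

theorem mem_lineThrough_gainMatrix {a b : GainEdge r w} (hab : a ≠ b) (x : GainEdge r w) :
    x ∈ lineThrough (vectorMatroid (gainMatrix r w)) a b ↔
      gainVecReal r x.tail x.head x.gain ∈ Submodule.span ℝ
        {gainVecReal r a.tail a.head a.gain, gainVecReal r b.tail b.head b.gain} := by
  unfold lineThrough
  rw [Set.mem_ofPred_eq]
  by_cases hxa : x = a
  · subst hxa
    simp only [true_or, true_iff]
    exact Submodule.subset_span (Or.inl rfl)
  by_cases hxb : x = b
  · subst hxb
    simp only [true_or, or_true, true_iff]
    exact Submodule.subset_span (Or.inr rfl)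
  have hx : x ∉ ({a, b} : Set (GainEdge r w)) := by simp [hxa, hxb]
  rw [show ({a, b, x} : Set (GainEdge r w)) = insert x {a, b} by
      ext y; simp only [Set.mem_insert_iff, Set.mem_singleton_iff]; tauto,
    vectorMatroid_indep_iff, linearIndepOn_insert hx, Set.image_pair]
  have := (vectorMatroid_indep_iff _ _).1 (gainMatrix_indep_pair a b)
  simp only [hxa, hxb, this, false_or, true_and, not_not, gainMatrix_col]

/-- Between `u` and `v` the gain only adds a multiple of the loop vector; conversely, vertex
coordinates force the ends of a non-loop edge in this span to be `u` and `v`. The only edge with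
equal ends is the loop at 0. -/
theorem mem_pencil_iff {u v : ℕ} (hu : u < r) (hv : v < r) (x : GainEdge r w) :
    x ∈ pencil r w u v ↔ gainVecReal r x.tail x.head x.gain ∈
      Submodule.span ℝ {gainVecReal r 0 0 1, gainVecReal r u v 0} := by
  rw [Submodule.mem_span_pair]
  obtain ⟨t, h, a, ht, hh, hx⟩ := x
  have hr : 0 < r := by omega
  constructor
  · rintro (h1 | ⟨h1, h2⟩ | ⟨h1, h2⟩) <;> dsimp only at h1 ⊢
    · obtain ⟨rfl, rfl, rfl⟩ : t = 0 ∧ h = 0 ∧ a = 1 := by omega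
      exact ⟨1, 0, by simp⟩
    · dsimp only at h2
      subst h1 h2
      refine ⟨a, 1, ?_⟩
      ext i
      by_cases hi : (i : ℕ) = 0 <;> simp [gainVecReal, gainVec, hi]
    · dsimp only at h2
      subst h1 h2
      refine ⟨a, -1, ?_⟩
      ext i
      by_cases hi : (i : ℕ) = 0 <;> simp [gainVecReal, gainVec, hi]
  · rintro ⟨p, q, hpq⟩
    dsimp only at hpq
    have H : ∀ z, z < r → q * ((if z = u then 1 else 0) - (if z = v then 1 else 0)) =
        ((if z = t then 1 else 0) - (if z = h then 1 else 0) : ℝ) := by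
      intro z hz
      have := congrArg (vertexCoord r ⟨z, hz⟩) hpq
      rw [map_add, map_smul, map_smul, vertexCoord_gainVecReal _ hr hr,
        vertexCoord_gainVecReal _ hu hv, vertexCoord_gainVecReal _ ht hh] at this
      simpa using this
    by_cases hth : t = h
    · exact Or.inl hth
    have h1 : t = u ∨ t = v := by
      by_contra! h0
      have := H t ht
      simp [h0.1, h0.2, hth] at this
    have h2 : h = u ∨ h = v := by
      by_contra! h0
      have := H h hh
      simp [h0.1, h0.2, Ne.symm hth] at this
    right
    dsimp only
    omega

theorem finrank_span_pair_gainVecReal {a b : GainEdge r w} (hab : a ≠ b) :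
    Module.finrank ℝ (Submodule.span ℝ
      {gainVecReal r a.tail a.head a.gain, gainVecReal r b.tail b.head b.gain}) = 2 := by
  have h : LinearIndependent ℝ ![gainVecReal r a.tail a.head a.gain,
      gainVecReal r b.tail b.head b.gain] :=
    LinearIndependent.pair_iff.2 fun c d => gainVecReal_pair_indep hab
  have := finrank_span_eq_card h
  rwa [Matrix.range_cons_cons_empty, Fintype.card_fin] at this

theorem span_pair_eq_of_mem_pencil {u v : ℕ} (hu : u < r) (hv : v < r) {a b : GainEdge r w}
    (hab : a ≠ b) (ha : a ∈ pencil r w u v) (hb : b ∈ pencil r w u v) :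
    Submodule.span ℝ
      {gainVecReal r a.tail a.head a.gain, gainVecReal r b.tail b.head b.gain} =
      Submodule.span ℝ {gainVecReal r 0 0 1, gainVecReal r u v 0} := by
  classical
  apply Submodule.eq_of_le_of_finrank_le
  · rw [Submodule.span_le]
    rintro _ (rfl | rfl)
    · exact (mem_pencil_iff hu hv a).1 ha
    · exact (mem_pencil_iff hu hv b).1 hb
  · rw [finrank_span_pair_gainVecReal hab]
    have := finrank_span_finset_le_card (R := ℝ)
      ({gainVecReal r 0 0 1, gainVecReal r u v 0} : Finset (Fin r → ℝ))
    rw [Finset.coe_pair] at this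
    exact this.trans Finset.card_le_two

theorem lineThrough_eq_pencil {u v : ℕ} (hu : u < r) (hv : v < r) {a b : GainEdge r w}
    (hab : a ≠ b) (ha : a ∈ pencil r w u v) (hb : b ∈ pencil r w u v) :
    lineThrough (vectorMatroid (gainMatrix r w)) a b = pencil r w u v := by
  ext x
  rw [mem_lineThrough_gainMatrix hab, mem_pencil_iff hu hv,
    span_pair_eq_of_mem_pencil hu hv hab ha hb]

theorem exists_mem_pencil (hr : 2 ≤ r) (b : GainEdge r w) :
    ∃ u v, u < v ∧ v < r ∧ b ∈ pencil r w u v := by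
  rcases lt_trichotomy b.tail b.head with h | h | h
  · exact ⟨_, _, h, b.head_lt, Or.inr (Or.inl ⟨rfl, rfl⟩)⟩
  · exact ⟨0, 1, by omega, by omega, Or.inl h⟩
  · exact ⟨_, _, h, b.tail_lt, Or.inr (Or.inr ⟨rfl, rfl⟩)⟩

/-- Neither edge is the loop and their endpoint sets differ, so each has a private endpoint, `p` for
`a` and `q` for `b`. A third point of the line needs both coefficients nonzero, hence joins `p` and
`q`; there is at most one. -/
theorem ncard_lineThrough_le (hr : 2 ≤ r) {a b : GainEdge r w} (hab : a ≠ b)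
    (h : ¬ ∃ u v, u < v ∧ v < r ∧ a ∈ pencil r w u v ∧ b ∈ pencil r w u v) :
    (lineThrough (vectorMatroid (gainMatrix r w)) a b).ncard ≤ 3 := by
  classical
  have hta : a.tail ≠ a.head := fun h0 => by
    obtain ⟨u, v, h1, h2, h3⟩ := exists_mem_pencil hr b
    exact h ⟨u, v, h1, h2, Or.inl h0, h3⟩
  have htb : b.tail ≠ b.head := fun h0 => by
    obtain ⟨u, v, h1, h2, h3⟩ := exists_mem_pencil hr a
    exact h ⟨u, v, h1, h2, h3, Or.inl h0⟩
  have hne : ¬ ((b.tail = a.tail ∧ b.head = a.head) ∨ (b.tail = a.head ∧ b.head = a.tail)) := by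
    intro h0
    rcases lt_or_gt_of_ne hta with h1 | h1
    · exact h ⟨_, _, h1, a.head_lt, Or.inr (Or.inl ⟨rfl, rfl⟩), Or.inr h0⟩
    · exact h ⟨_, _, h1, a.tail_lt, Or.inr (Or.inr ⟨rfl, rfl⟩), Or.inr h0.symm⟩
  have ha1 := a.tail_lt
  have ha2 := a.head_lt
  have hb1 := b.tail_lt
  have hb2 := b.head_lt
  obtain ⟨p, hpr, hpa, hpb, hpb'⟩ :
      ∃ p < r, (p = a.tail ∨ p = a.head) ∧ p ≠ b.tail ∧ p ≠ b.head := by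
    by_cases h0 : a.tail = b.tail ∨ a.tail = b.head
    · exact ⟨a.head, a.head_lt, Or.inr rfl, by omega, by omega⟩
    · exact ⟨a.tail, a.tail_lt, Or.inl rfl, by omega, by omega⟩
  obtain ⟨q, hqr, hqb, hqa, hqa'⟩ :
      ∃ q < r, (q = b.tail ∨ q = b.head) ∧ q ≠ a.tail ∧ q ≠ a.head := by
    by_cases h0 : b.tail = a.tail ∨ b.tail = a.head
    · exact ⟨b.head, b.head_lt, Or.inr rfl, by omega, by omega⟩
    · exact ⟨b.tail, b.tail_lt, Or.inl rfl, by omega, by omega⟩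
  have hpq : p ≠ q := by omega
  have pos_a : ((if p = a.tail then 1 else 0) - (if p = a.head then 1 else 0) : ℝ) ≠ 0 := by
    rcases hpa with rfl | rfl
    · simp [hta]
    · simp [Ne.symm hta]
  have pos_b : ((if q = b.tail then 1 else 0) - (if q = b.head then 1 else 0) : ℝ) ≠ 0 := by
    rcases hqb with rfl | rfl
    · simp [htb]
    · simp [Ne.symm htb]
  have coords : ∀ {t h g : ℕ}, t < r → h < r → ∀ c d : ℝ,
      c • gainVecReal r a.tail a.head a.gain + d • gainVecReal r b.tail b.head b.gain =
        gainVecReal r t h g →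
      c * ((if p = a.tail then 1 else 0) - (if p = a.head then 1 else 0)) =
        ((if p = t then 1 else 0) - (if p = h then 1 else 0) : ℝ) ∧
      d * ((if q = b.tail then 1 else 0) - (if q = b.head then 1 else 0)) =
        ((if q = t then 1 else 0) - (if q = h then 1 else 0) : ℝ) := by
    intro t h g ht hh c d hcd
    have h1 := congrArg (vertexCoord r ⟨p, hpr⟩) hcd
    have h2 := congrArg (vertexCoord r ⟨q, hqr⟩) hcd
    rw [map_add, map_smul, map_smul, vertexCoord_gainVecReal _ a.tail_lt a.head_lt,
      vertexCoord_gainVecReal _ b.tail_lt b.head_lt, vertexCoord_gainVecReal _ ht hh] at h1 h2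
    constructor
    · simpa [hpb, hpb'] using h1
    · simpa [hqa, hqa'] using h2
  have third : ∀ x ∈ lineThrough (vectorMatroid (gainMatrix r w)) a b, x ≠ a → x ≠ b →
      x ∈ pencil r w p q := by
    intro x hx hxa hxb
    rw [mem_lineThrough_gainMatrix hab, Submodule.mem_span_pair] at hx
    obtain ⟨c, d, hcd⟩ := hx
    have hc : c ≠ 0 := by
      rintro rfl
      have := (gainVecReal_pair_indep hxb (c := 1) (d := -d) (by rw [← hcd]; simp)).1
      norm_num at this
    have hd : d ≠ 0 := by
      rintro rfl
      have := (gainVecReal_pair_indep hxa (c := 1) (d := -c) (by rw [← hcd]; simp)).1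
      norm_num at this
    obtain ⟨h1, h2⟩ := coords x.tail_lt x.head_lt c d hcd
    have h3 : p = x.tail ∨ p = x.head := by
      by_contra! h0
      rw [if_neg h0.1, if_neg h0.2, sub_zero] at h1
      exact mul_ne_zero hc pos_a h1
    have h4 : q = x.tail ∨ q = x.head := by
      by_contra! h0
      rw [if_neg h0.1, if_neg h0.2, sub_zero] at h2
      exact mul_ne_zero hd pos_b h2
    right
    omega
  have unique : ∀ x ∈ lineThrough (vectorMatroid (gainMatrix r w)) a b,
      ∀ y ∈ lineThrough (vectorMatroid (gainMatrix r w)) a b,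
      x ≠ a → x ≠ b → y ≠ a → y ≠ b → x = y := by
    intro x hx y hy hxa hxb hya hyb
    by_contra hxy
    -- Two further points would span the plane of the pencil of `p` and `q`, which contains the loop
    -- vector. The loop has zero coordinates at `p` and `q`, so both its coefficients in `a` and `b`
    -- vanish, which is absurd.
    have h1 := span_pair_eq_of_mem_pencil hpr hqr hxy (third x hx hxa hxb) (third y hy hya hyb)
    have h2 : gainVecReal r 0 0 1 ∈ Submodule.span ℝ
        {gainVecReal r a.tail a.head a.gain, gainVecReal r b.tail b.head b.gain} := by
      have h3 : gainVecReal r 0 0 1 ∈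
          Submodule.span ℝ {gainVecReal r 0 0 1, gainVecReal r p q 0} :=
        Submodule.subset_span (Or.inl rfl)
      rw [← h1] at h3
      refine (Submodule.span_le.2 ?_) h3
      rintro _ (rfl | rfl)
      · exact (mem_lineThrough_gainMatrix hab x).1 hx
      · exact (mem_lineThrough_gainMatrix hab y).1 hy
    obtain ⟨c, d, hcd⟩ := Submodule.mem_span_pair.1 h2
    have hr0 : 0 < r := by omega
    obtain ⟨h4, h5⟩ := coords hr0 hr0 c d hcd
    rw [sub_self] at h4 h5
    have hc := (mul_eq_zero.1 h4).resolve_right pos_a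
    have hd := (mul_eq_zero.1 h5).resolve_right pos_b
    have := congrFun hcd ⟨0, hr0⟩
    rw [gainVecReal_zero, hc, hd] at this
    simp at this
  have hsub : ∃ y, lineThrough (vectorMatroid (gainMatrix r w)) a b ⊆ {a, b, y} := by
    by_cases h0 : ∃ y ∈ lineThrough (vectorMatroid (gainMatrix r w)) a b, y ≠ a ∧ y ≠ b
    · obtain ⟨y, hy, hya, hyb⟩ := h0
      refine ⟨y, fun x hx => ?_⟩
      by_cases hxa : x = a
      · exact Or.inl hxa
      by_cases hxb : x = b
      · exact Or.inr (Or.inl hxb)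
      exact Or.inr (Or.inr (unique x hx y hy hxa hxb hya hyb))
    · push Not at h0
      refine ⟨a, fun x hx => ?_⟩
      by_cases hxa : x = a
      · exact Or.inl hxa
      · exact Or.inr (Or.inl (h0 x hx hxa))
  obtain ⟨y, hy⟩ := hsub
  refine (Set.ncard_le_ncard hy (Set.toFinite _)).trans ?_
  refine (Set.ncard_insert_le _ _).trans ?_
  have := Set.ncard_insert_le b {y}
  rw [Set.ncard_singleton] at this
  omega

theorem ncard_pencil {u v : ℕ} (huv : u < v) (hv : v < r) :
    (pencil r w u v).ncard = w u + w v + 2 := by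
  have hcard : (Finset.Icc (-(w v : ℤ)) (w u + 1)).card = w u + w v + 2 := by
    rw [Int.card_Icc]
    omega
  rw [← hcard, ← Set.ncard_coe_finset]
  -- Signed gains label the edges: 0, …, `w u` from `u` to `v`, and -1, …, `-w v` back, since the
  -- edge of gain 0 leaves the smaller vertex. The loop takes the spare label `w u + 1`.
  refine Set.ncard_congr (fun e _ => if e.tail = e.head then (w u : ℤ) + 1 else
    if e.tail = u then (e.gain : ℤ) else -e.gain) ?_ ?_ ?_
  · rintro ⟨t, h, a, ht, hh, hx⟩ he
    simp only [pencil, Set.mem_ofPred_eq] at he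
    simp only [Finset.coe_Icc, Set.mem_Icc]
    rcases he with h1 | ⟨rfl, rfl⟩ | ⟨rfl, rfl⟩
    · rw [if_pos h1]
      omega
    · rw [if_neg (by omega), if_pos rfl]
      omega
    · rw [if_neg (by omega), if_neg (by omega)]
      omega
  · rintro ⟨t, h, a, ht, hh, hx⟩ ⟨t', h', a', ht', hh', hx'⟩ he he' heq
    simp only [pencil, Set.mem_ofPred_eq] at he he'
    dsimp only at heq
    rw [GainEdge.mk.injEq]
    rcases he with h1 | ⟨rfl, rfl⟩ | ⟨rfl, rfl⟩ <;> rcases he' with h2 | ⟨rfl, rfl⟩ | ⟨rfl, rfl⟩ <;>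
      split_ifs at heq <;> omega
  · intro z hz
    simp only [Finset.coe_Icc, Set.mem_Icc] at hz
    by_cases h1 : z = w u + 1
    · refine ⟨⟨0, 0, 1, by omega, by omega, by omega⟩, Or.inl rfl, ?_⟩
      simp [h1]
    by_cases h2 : 0 ≤ z
    · refine ⟨⟨u, v, z.toNat, by omega, by omega, by omega⟩, Or.inr (Or.inl ⟨rfl, rfl⟩), ?_⟩
      dsimp only
      rw [if_neg (show u ≠ v by omega), if_pos rfl]
      omega
    · refine ⟨⟨v, u, (-z).toNat, by omega, by omega, by omega⟩, Or.inr (Or.inr ⟨rfl, rfl⟩), ?_⟩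
      dsimp only
      rw [if_neg (show v ≠ u by omega), if_neg (show v ≠ u by omega)]
      omega

/-- The pairs `u < v < r` of vertices with `w u + w v = k`. -/
def pairsWithSum (r : ℕ) (w : ℕ → ℕ) (k : ℕ) : Finset (ℕ × ℕ) :=
  (Finset.range r ×ˢ Finset.range r).filter fun p => p.1 < p.2 ∧ w p.1 + w p.2 = k

theorem mem_pairsWithSum {k : ℕ} {p : ℕ × ℕ} :
    p ∈ pairsWithSum r w k ↔ p.1 < p.2 ∧ p.2 < r ∧ w p.1 + w p.2 = k := by
  simp only [pairsWithSum, Finset.mem_filter, Finset.mem_product, Finset.mem_range]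
  omega

/-- `2 ≤ k` asks for at least four points, which rules out every line that is not a pencil. -/
theorem ncard_linesOfSize_gainMatrix (hr : 2 ≤ r) {k : ℕ} (hk : 2 ≤ k) :
    (linesOfSize (vectorMatroid (gainMatrix r w)) (k + 2)).ncard = (pairsWithSum r w k).card := by
  have himage : linesOfSize (vectorMatroid (gainMatrix r w)) (k + 2) =
      (fun p : ℕ × ℕ => pencil r w p.1 p.2) '' (pairsWithSum r w k : Set (ℕ × ℕ)) := by
    ext L
    constructor
    · rintro ⟨⟨a, b, hab, rfl⟩, hs⟩
      by_cases h : ∃ u v, u < v ∧ v < r ∧ a ∈ pencil r w u v ∧ b ∈ pencil r w u v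
      · obtain ⟨u, v, huv, hv, ha, hb⟩ := h
        have hL := lineThrough_eq_pencil (huv.trans hv) hv hab ha hb
        rw [hL, ncard_pencil huv hv] at hs
        exact ⟨(u, v), mem_pairsWithSum.2 ⟨huv, hv, by dsimp only; omega⟩, hL.symm⟩
      · have := ncard_lineThrough_le hr hab h
        omega
    · rintro ⟨⟨u, v⟩, hp, rfl⟩
      obtain ⟨huv, hv, hk'⟩ := mem_pairsWithSum.1 hp
      dsimp only at huv hv hk' ⊢
      have hn := ncard_pencil (w := w) huv hv
      obtain ⟨a, ha, b, hb, hab⟩ := (Set.one_lt_ncard (Set.toFinite _)).1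
        (show 1 < (pencil r w u v).ncard by omega)
      exact ⟨⟨a, b, hab, (lineThrough_eq_pencil (huv.trans hv) hv hab ha hb).symm⟩, by omega⟩
  rw [himage, Set.InjOn.ncard_image, Set.ncard_coe_finset]
  rintro ⟨u, v⟩ hp ⟨u', v'⟩ hp' h
  obtain ⟨huv, hv, -⟩ := mem_pairsWithSum.1 hp
  obtain ⟨huv', hv', -⟩ := mem_pairsWithSum.1 hp'
  dsimp only at h huv hv huv' hv'
  -- The edge of gain 0 from `u` to `v` recovers the pair from its pencil.
  have : (⟨u, v, 0, by omega, hv, by omega⟩ : GainEdge r w) ∈ pencil r w u' v' := by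
    rw [← h]
    exact Or.inr (Or.inl ⟨rfl, rfl⟩)
  simp only [pencil, Set.mem_ofPred_eq] at this
  rw [Prod.mk.injEq]
  omega

end Lines

/-! ### Recovering the weights from their pairwise sums -/

section Weights

variable {r : ℕ} {w w' : ℕ → ℕ}

theorem sum_add_sum_pairs {M : Type*} [AddCommMonoid M] (r : ℕ) (f : ℕ × ℕ → M)
    (hf : ∀ p, f p.swap = f p) :
    ∑ p ∈ Finset.range r ×ˢ Finset.range r, f p =
      2 • ∑ p ∈ (Finset.range r ×ˢ Finset.range r).filter (fun p => p.1 < p.2), f p +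
        ∑ v ∈ Finset.range r, f (v, v) := by
  have hswap : ∑ p ∈ (Finset.range r ×ˢ Finset.range r).filter (fun p => p.2 < p.1), f p =
      ∑ p ∈ (Finset.range r ×ˢ Finset.range r).filter (fun p => p.1 < p.2), f p := by
    refine Finset.sum_bij' (fun p _ => p.swap) (fun p _ => p.swap) ?_ ?_ ?_ ?_
      (fun p _ => (hf p).symm) <;> simp +contextual
  have hdiag : ∑ p ∈ (Finset.range r ×ˢ Finset.range r).filter (fun p => p.1 = p.2), f p =
      ∑ v ∈ Finset.range r, f (v, v) := by
    refine Finset.sum_bij' (fun p _ => p.1) (fun v _ => (v, v)) ?_ ?_ ?_ ?_ ?_ <;>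
      simp +contextual
  rw [← Finset.sum_filter_add_sum_filter_not _ (fun p : ℕ × ℕ => p.1 < p.2), two_smul, add_assoc,
    ← hdiag]
  nth_rewrite 3 [← hswap]
  congr 1
  rw [← Finset.sum_filter_add_sum_filter_not _ (fun p : ℕ × ℕ => p.2 < p.1),
    Finset.filter_filter, Finset.filter_filter]
  congr 2 <;>
  · apply Finset.filter_congr
    intro p _
    omega

/-- Each weight lies in `r - 1` pairs; this form avoids subtraction and division in ℕ. -/
theorem sum_weights_pairs (r : ℕ) (w : ℕ → ℕ) :
    2 * ∑ p ∈ (Finset.range r ×ˢ Finset.range r).filter (fun p => p.1 < p.2), (w p.1 + w p.2) +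
      2 * ∑ v ∈ Finset.range r, w v = 2 * (r * ∑ v ∈ Finset.range r, w v) := by
  have h := sum_add_sum_pairs r (fun p => w p.1 + w p.2) (fun p => add_comm _ _)
  rw [Finset.sum_add_distrib, Finset.sum_product, Finset.sum_product] at h
  simp only [Finset.sum_const, Finset.card_range, smul_eq_mul, ← Finset.mul_sum, ← two_mul] at h
  linarith

theorem sum_card_pairsWithSum {M : Type*} [AddCommMonoid M] {B : ℕ}
    (hB : ∀ v < r, w v ≤ B) (f : ℕ → M) :
    ∑ p ∈ (Finset.range r ×ˢ Finset.range r).filter (fun p => p.1 < p.2), f (w p.1 + w p.2) =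
      ∑ k ∈ Finset.range (2 * B + 2), (pairsWithSum r w k).card • f k := by
  rw [← Finset.sum_fiberwise_of_maps_to (t := Finset.range (2 * B + 2))
    (g := fun p : ℕ × ℕ => w p.1 + w p.2)]
  · refine Finset.sum_congr rfl fun k _ => ?_
    rw [Finset.filter_filter, ← Finset.sum_const]
    refine Finset.sum_congr rfl fun p hp => ?_
    rw [(Finset.mem_filter.1 hp).2.2]
  · intro p hp
    simp only [Finset.mem_filter, Finset.mem_product, Finset.mem_range] at hp ⊢
    have := hB _ hp.1.1
    have := hB _ hp.1.2
    omega

/-- The number of pairs and the total of their sums give two linear equations for the two missing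
counts: the total yields `k = 1`, then the number yields `k = 0`. -/
theorem card_pairsWithSum_eq (hsum : ∑ v ∈ Finset.range r, w v = ∑ v ∈ Finset.range r, w' v)
    (h : ∀ k, 2 ≤ k → (pairsWithSum r w k).card = (pairsWithSum r w' k).card) (k : ℕ) :
    (pairsWithSum r w k).card = (pairsWithSum r w' k).card := by
  have hB : ∀ v < r, w v ≤ ∑ v ∈ Finset.range r, w v := fun v hv =>
    Finset.single_le_sum (f := w) (fun _ _ => Nat.zero_le _) (Finset.mem_range.2 hv)
  have hB' : ∀ v < r, w' v ≤ ∑ v ∈ Finset.range r, w v := fun v hv => hsum ▸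
    Finset.single_le_sum (f := w') (fun _ _ => Nat.zero_le _) (Finset.mem_range.2 hv)
  have c1 := sum_card_pairsWithSum hB (fun _ => 1)
  have c2 := sum_card_pairsWithSum hB' (fun _ => 1)
  have s1 := sum_card_pairsWithSum hB (fun k => k)
  have s2 := sum_card_pairsWithSum hB' (fun k => k)
  have t1 := sum_weights_pairs r w
  have t2 := sum_weights_pairs r w'
  rw [c1] at c2
  rw [s1] at t1
  rw [s2, ← hsum] at t2
  rw [Finset.sum_range_succ', Finset.sum_range_succ', Finset.sum_range_succ',
    Finset.sum_range_succ'] at c2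
  rw [Finset.sum_range_succ', Finset.sum_range_succ'] at t1 t2
  have e1 : ∀ f : ℕ → ℕ, ∑ k ∈ Finset.range (2 * ∑ v ∈ Finset.range r, w v),
      (pairsWithSum r w (k + 1 + 1)).card • f k =
      ∑ k ∈ Finset.range (2 * ∑ v ∈ Finset.range r, w v),
        (pairsWithSum r w' (k + 1 + 1)).card • f k := fun f =>
    Finset.sum_congr rfl fun k _ => by rw [h (k + 1 + 1) (by omega)]
  rw [e1 (fun _ => 1)] at c2
  rw [e1 (fun k => k + 1 + 1)] at t1
  simp only [smul_eq_mul, zero_add] at c2 t1 t2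
  rcases Nat.lt_or_ge k 2 with hk | hk
  · interval_cases k <;> omega
  · exact h k hk

open Polynomial in
/-- If two systems of natural numbers that both contain `0` have the same pairwise sums, then they
contain every number equally often. -/
theorem card_weights_eq (h0 : ∃ v < r, w v = 0) (h0' : ∃ v < r, w' v = 0)
    (h : ∀ k, (pairsWithSum r w k).card = (pairsWithSum r w' k).card) (k : ℕ) :
    ((Finset.range r).filter (fun v => w v = k)).card =
      ((Finset.range r).filter (fun v => w' v = k)).card := by
  set P : (ℕ → ℕ) → ℤ[X] := fun w => ∑ v ∈ Finset.range r, X ^ w v with hP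
  have coeff_P : ∀ w k, (P w).coeff k = ((Finset.range r).filter (fun v => w v = k)).card := by
    intro w k
    simp only [hP, finsetSum_coeff, coeff_X_pow, Finset.sum_boole, eq_comm]
  have pos_P : ∀ w : ℕ → ℕ, (∃ v < r, w v = 0) → 1 ≤ (P w).coeff 0 := by
    rintro w ⟨v, hv, hw⟩
    rw [coeff_P]
    exact_mod_cast Finset.card_pos.2 ⟨v, Finset.mem_filter.2 ⟨Finset.mem_range.2 hv, hw⟩⟩
  -- P(X)² is twice the generating polynomial of the pair sums plus the diagonal P(X²).
  have square : ∀ w, P w * P w = 2 • ∑ p ∈ (Finset.range r ×ˢ Finset.range r).filter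
      (fun p => p.1 < p.2), X ^ (w p.1 + w p.2) + expand ℤ 2 (P w) := by
    intro w
    have := sum_add_sum_pairs r (fun p => (X : ℤ[X]) ^ (w p.1 + w p.2))
      (fun p => by simp [add_comm])
    simp only [hP, map_sum, map_pow, expand_X, Finset.sum_mul_sum, ← Finset.sum_product',
      ← pow_add, ← pow_mul, two_mul]
    exact this
  have hT : ∑ p ∈ (Finset.range r ×ˢ Finset.range r).filter (fun p => p.1 < p.2),
      (X : ℤ[X]) ^ (w p.1 + w p.2) = ∑ p ∈ (Finset.range r ×ˢ Finset.range r).filter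
      (fun p => p.1 < p.2), (X : ℤ[X]) ^ (w' p.1 + w' p.2) := by
    ext k
    simp only [finsetSum_coeff, coeff_X_pow, Finset.sum_boole, Finset.filter_filter]
    have := h k
    simp only [pairsWithSum, eq_comm (a := _ + _)] at this
    exact_mod_cast this
  have hD : (P w - P w') * (P w + P w') = expand ℤ 2 (P w - P w') := by
    have h1 := square w
    have h2 := square w'
    rw [map_sub]
    rw [hT] at h1
    linear_combination h1 - h2
  -- Compare coefficients in D(X)(P + P')(X) = D(X²) at the lowest degree d of D. On the left stands
  -- the lowest coefficient times (P + P')(0) ≥ 2; on the right, 0 if d > 0 and that coefficient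
  -- itself if d = 0. Both are impossible.
  have hzero : P w - P w' = 0 := by
    by_contra hne
    set D := P w - P w'
    have hpos : 2 ≤ (P w + P w').coeff 0 := by
      rw [coeff_add]
      have := pos_P w h0
      have := pos_P w' h0'
      omega
    have htr : (P w + P w').natTrailingDegree = 0 :=
      natTrailingDegree_eq_zero.2 (Or.inr (by omega))
    have hk := coeff_mul_natTrailingDegree_add_natTrailingDegree (p := D) (q := P w + P w')
    rw [hD, htr, add_zero, trailingCoeff, trailingCoeff, htr, coeff_expand two_pos] at hk
    have hd : D.coeff D.natTrailingDegree ≠ 0 := trailingCoeff_nonzero_iff_nonzero.2 hne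
    by_cases hk0 : D.natTrailingDegree = 0
    · simp only [hk0, dvd_zero, if_true, Nat.zero_div] at hk hd
      have : D.coeff 0 * ((P w + P w').coeff 0 - 1) = 0 := by linarith
      rcases mul_eq_zero.1 this with h1 | h1
      · exact hd h1
      · omega
    · have hlt : D.natTrailingDegree / 2 < D.natTrailingDegree := by omega
      rw [coeff_eq_zero_of_lt_natTrailingDegree hlt, ite_self] at hk
      rcases mul_eq_zero.1 hk.symm with h1 | h1
      · exact hd h1
      · omega
  have := congrArg (fun Q => Q.coeff k) (sub_eq_zero.1 hzero)
  rw [coeff_P, coeff_P] at this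
  exact_mod_cast this

end Weights

/-! ### Weights given by lists -/

theorem sum_range_getD {M : Type*} [AddCommMonoid M] (f : ℕ → M) (hf : f 0 = 0) :
    ∀ (l : List ℕ) (r : ℕ), l.length ≤ r →
      ∑ v ∈ Finset.range r, f (l.getD v 0) = (l.map f).sum
  | [], r, _ => by simp [hf]
  | a :: l, r, h => by
    obtain ⟨s, rfl⟩ := Nat.exists_eq_add_of_le' (Nat.pos_of_ne_zero (n := r) (by
      rintro rfl
      simp at h))
    rw [Finset.sum_range_succ', List.map_cons, List.sum_cons]
    simp only [List.getD_cons_succ, List.getD_cons_zero]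
    rw [sum_range_getD f hf l s (by simpa using h), add_comm]

theorem card_filter_getD {l : List ℕ} {r k : ℕ} (hl : l.length ≤ r) (hk : k ≠ 0) :
    ((Finset.range r).filter (fun v => l.getD v 0 = k)).card = l.count k := by
  rw [Finset.card_filter, sum_range_getD (fun n => if n = k then 1 else 0) (by simp [Ne.symm hk])
    l r hl, List.count_eq_length_filter]
  induction l with
  | nil => rfl
  | cons a l ih =>
    rw [List.map_cons, List.sum_cons, ih (by simp at hl; omega)]
    by_cases ha : a = k <;> simp [ha, add_comm]

/-- Lists are padded by zeros to weights on `r` vertices. The strict length bounds guarantee a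
vertex of weight 0; multiplicities of 0 are excluded because padding changes them. -/
theorem count_eq_of_isomorphic_gainMatrix {r : ℕ} {l l' : List ℕ} (hl : l.length < r)
    (hl' : l'.length < r) (hr : 2 ≤ r) (hsum : l.sum = l'.sum)
    (h : Isomorphic (vectorMatroid (gainMatrix r (fun v => l.getD v 0)))
      (vectorMatroid (gainMatrix r (fun v => l'.getD v 0)))) (k : ℕ) (hk : k ≠ 0) :
    l.count k = l'.count k := by
  have hz : ∀ l : List ℕ, l.length < r → ∃ v < r, l.getD v 0 = 0 := fun l hl =>
    ⟨l.length, hl, List.getD_eq_default _ _ le_rfl⟩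
  rw [← card_filter_getD hl.le hk, ← card_filter_getD hl'.le hk]
  refine card_weights_eq (hz l hl) (hz l' hl') (card_pairsWithSum_eq ?_ fun j hj => ?_) k
  · have h1 := sum_range_getD id rfl l r hl.le
    have h2 := sum_range_getD id rfl l' r hl'.le
    simp only [id, List.map_id] at h1 h2
    rw [h1, h2, hsum]
  · rw [← ncard_linesOfSize_gainMatrix hr hj, ← ncard_linesOfSize_gainMatrix hr hj]
    exact h.ncard_linesOfSize rfl rfl _

/-! ### The given matrices as gain graph matrices -/

section Columns

variable {r : ℕ} {w : ℕ → ℕ}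

theorem gainVec_loop (r : ℕ) : gainVec r 0 0 1 = unitVec r 0 := by
  ext x
  simp [gainVec, unitVec]

theorem gainVec_head_zero {r t : ℕ} (ht : t ≠ 0) (a : ℕ) :
    gainVec r t 0 a = (a : ℤ) • unitVec r 0 + unitVec r t := by
  ext x
  by_cases hx : (x : ℕ) = 0
  · simp [gainVec, unitVec, hx, Ne.symm ht]
  · simp [gainVec, unitVec, hx]

theorem gainVec_tail_zero {r h : ℕ} (hh : h ≠ 0) (a : ℕ) :
    gainVec r 0 h a = (a : ℤ) • unitVec r 0 - unitVec r h := by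
  ext x
  by_cases hx : (x : ℕ) = 0
  · simp [gainVec, unitVec, hx, Ne.symm hh]
  · simp [gainVec, unitVec, hx]

theorem gainVec_of_ne_zero {r t h : ℕ} (ht : t ≠ 0) (hh : h ≠ 0) (a : ℕ) :
    gainVec r t h a = (a : ℤ) • unitVec r 0 + unitVec r t - unitVec r h := by
  ext x
  by_cases hx : (x : ℕ) = 0
  · simp [gainVec, unitVec, hx, Ne.symm hh, Ne.symm ht]
  · simp [gainVec, unitVec, hx]

/-- The edges whose vectors are, up to sign, the columns `e_i` and `e_i - e_j`. -/
def cliqueEdge (hr : 0 < r) (h0 : 1 ≤ w 0) : CliqueIdx r → GainEdge r w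
  | .inl i => ⟨0, i, if (i : ℕ) = 0 then 1 else 0, hr, i.2, by split_ifs <;> omega⟩
  -- In this numbering, e₁ - e_j is an edge of gain 1 leaving vertex 0, available because `1 ≤ w 0`.
  | .inr p => ⟨p.1.1, p.1.2, if (p.1.1 : ℕ) = 0 then 1 else 0, p.1.1.2, p.1.2.2, by
      have := p.2
      split_ifs with h
      · rw [h]
        omega
      · omega⟩

theorem gainVec_cliqueEdge (hr : 0 < r) (h0 : 1 ≤ w 0) (c : CliqueIdx r) :
    (∀ x, gainMatrix r w x (cliqueEdge hr h0 c) = cliqueColumn r c x) ∨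
      (∀ x, gainMatrix r w x (cliqueEdge hr h0 c) = -cliqueColumn r c x) := by
  rcases c with i | ⟨⟨i, j⟩, hij⟩
  · by_cases hi : (i : ℕ) = 0
    · left
      intro x
      simp [gainMatrix, cliqueEdge, cliqueColumn, hi, gainVec_loop]
    · right
      intro x
      simp [gainMatrix, cliqueEdge, cliqueColumn, hi, gainVec_tail_zero]
  · left
    intro x
    have hj : (j : ℕ) ≠ 0 := by
      have : i < j := hij
      omega
    by_cases hi : (i : ℕ) = 0
    · simp [gainMatrix, cliqueEdge, cliqueColumn, hi, gainVec_tail_zero hj]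
    · simp [gainMatrix, cliqueEdge, cliqueColumn, hi, gainVec_of_ne_zero hi hj]

theorem cliqueEdge_injective (hr : 0 < r) (h0 : 1 ≤ w 0) :
    Function.Injective (cliqueEdge (w := w) hr h0) := by
  rintro (i | ⟨⟨i, j⟩, hij⟩) (i' | ⟨⟨i', j'⟩, hij'⟩) heq <;>
    simp only [cliqueEdge, GainEdge.mk.injEq] at heq
  · rw [Fin.ext heq.2.1]
  · have : i' < j' := hij'
    obtain ⟨h1, h2, h3⟩ := heq
    split_ifs at h3 <;> omega
  · have : i < j := hij
    obtain ⟨h1, h2, h3⟩ := heq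
    split_ifs at h3
    omega
  · obtain ⟨h1, h2, -⟩ := heq
    obtain rfl := Fin.ext h1
    obtain rfl := Fin.ext h2
    rfl

theorem mem_range_cliqueEdge (hr : 0 < r) (h0 : 1 ≤ w 0) (e : GainEdge r w) :
    e ∈ Set.range (cliqueEdge (w := w) hr h0) ↔
      e.gain = 0 ∨ (e.tail = 0 ∧ e.gain = 1) := by
  constructor
  · rintro ⟨i | ⟨⟨i, j⟩, hij⟩, rfl⟩ <;> simp only [cliqueEdge] <;> split_ifs <;> simp_all
  · obtain ⟨t, h, a, ht, hh, hv⟩ := e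
    dsimp only
    intro he
    by_cases h1 : t < h
    · by_cases h2 : t = 0 ∧ a = 0
      · refine ⟨.inl ⟨h, hh⟩, ?_⟩
        ext <;> simp only [cliqueEdge] <;> first | omega | (split_ifs <;> omega)
      · refine ⟨.inr ⟨(⟨t, ht⟩, ⟨h, hh⟩), h1⟩, ?_⟩
        ext <;> simp only [cliqueEdge]
        split_ifs <;> omega
    · refine ⟨.inl ⟨0, hr⟩, ?_⟩
      ext <;> simp only [cliqueEdge] <;> first | omega | (split_ifs <;> omega)

/-- A matrix that extends the columns `e_i` and `e_i - e_j` by the vectors of the remaining edges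
represents the matroid of the gain graph. -/
theorem isomorphic_gainMatrix_of_extension {ι : Type*} [Finite ι] (hr : 0 < r) (h0 : 1 ≤ w 0)
    (f : ι → Fin r → ℤ) (φ : ι → GainEdge r w) (hφ : Function.Injective φ)
    (hrange : ∀ e, e ∈ Set.range φ ↔ ¬ (e.gain = 0 ∨ (e.tail = 0 ∧ e.gain = 1)))
    (hf : ∀ c x, gainMatrix r w x (φ c) = f c x) :
    Isomorphic (vectorMatroid (Matrix.of fun x c => Sum.elim (cliqueColumn r) f c x))
      (vectorMatroid (gainMatrix r w)) := by
  have hbij : Function.Bijective (Sum.elim (cliqueEdge (w := w) hr h0) φ) := by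
    constructor
    · refine (cliqueEdge_injective hr h0).sumElim hφ fun a b hab => ?_
      exact (hrange (φ b)).1 ⟨b, rfl⟩ ((mem_range_cliqueEdge hr h0 _).1 ⟨a, hab⟩)
    · intro e
      by_cases he : e.gain = 0 ∨ (e.tail = 0 ∧ e.gain = 1)
      · obtain ⟨c, hc⟩ := (mem_range_cliqueEdge hr h0 e).2 he
        exact ⟨.inl c, hc⟩
      · obtain ⟨c, hc⟩ := (hrange e).2 he
        exact ⟨.inr c, hc⟩
  refine isomorphic_of_columns _ _ (Equiv.ofBijective _ hbij) ?_
  rintro (c | c)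
  · exact gainVec_cliqueEdge hr h0 c
  · exact Or.inl (hf c)

end Columns

/-- With all weight at vertex 0, the edges of gain 1 leaving it are already the e₁ - e_j, so gains
2, …, Δ remain for the additional columns. -/
theorem isomorphic_leeMatrix {Δ r : ℕ} (hΔ : 2 ≤ Δ) (hr : 2 ≤ r) :
    Isomorphic (vectorMatroid (leeMatrix Δ r))
      (vectorMatroid (gainMatrix r (fun v => [Δ].getD v 0))) := by
  have hw : ∀ v, [Δ].getD v 0 = if v = 0 then Δ else 0 := by
    rintro (_ | v) <;> simp
  refine isomorphic_gainMatrix_of_extension (by omega) (by simp; omega) (leeColumn Δ r)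
    (fun c => ⟨0, c.1.1, c.2 + 2, by omega, c.1.1.2, by
      have := c.1.2
      have := c.2.2
      rw [hw, if_pos rfl]
      omega⟩) ?_ ?_ ?_
  · rintro ⟨⟨i, hi⟩, k⟩ ⟨⟨i', hi'⟩, k'⟩ heq
    simp only [GainEdge.mk.injEq] at heq
    obtain ⟨-, h1, h2⟩ := heq
    obtain rfl := Fin.ext h1
    obtain rfl : k = k' := Fin.ext (by omega)
    rfl
  · intro e
    constructor
    · rintro ⟨c, rfl⟩
      dsimp only
      omega
    · obtain ⟨t, h, a, ht, hh, hv⟩ := e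
      dsimp only
      rw [hw] at hv
      intro he
      have ht0 : t = 0 := by
        split_ifs at hv <;> omega
      rw [if_pos ht0] at hv
      refine ⟨(⟨⟨h, hh⟩, ?_⟩, ⟨a - 2, ?_⟩), ?_⟩
      · dsimp only
        omega
      · omega
      · ext <;> dsimp only <;> omega
  · intro c x
    simp [gainMatrix, leeColumn, gainVec_tail_zero c.1.2]

/-- Weight 1 at vertex 0 accounts for the e₁ - e_j only. Each part sits at its own nonzero vertex;
head 0 gives the columns k e₁ + e_{i+1}, any other head the columns with - e_j. -/
theorem isomorphic_partColumn {r : ℕ} {l : List ℕ} (hl : l.length + 1 < r) :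
    Isomorphic (vectorMatroid (Matrix.of fun x c => Sum.elim (cliqueColumn r) (partColumn l r) c x))
      (vectorMatroid (gainMatrix r (fun v => (1 :: l).getD v 0))) := by
  have hw : ∀ i : Fin l.length, (1 :: l).getD (i + 1) 0 = l.get i := fun i => by simp
  refine isomorphic_gainMatrix_of_extension (by omega) (by simp) (partColumn l r)
    (fun
      | .inl ⟨i, k⟩ => ⟨i + 1, 0, k + 1, by omega, by omega, by
          rw [hw]
          omega⟩
      | .inr ⟨i, k, j⟩ => ⟨i + 1, j.1, k + 1, by omega, j.1.2, by
          have := j.2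
          rw [hw]
          omega⟩) ?_ ?_ ?_
  · rintro (⟨i, k⟩ | ⟨i, k, j, hj⟩) (⟨i', k'⟩ | ⟨i', k', j', hj'⟩) heq <;>
      simp only [GainEdge.mk.injEq] at heq
    · obtain ⟨h1, -, h2⟩ := heq
      obtain rfl : i = i' := Fin.ext (by omega)
      obtain rfl : k = k' := Fin.ext (by omega)
      rfl
    · omega
    · omega
    · obtain ⟨h1, h3, h2⟩ := heq
      obtain rfl : i = i' := Fin.ext (by omega)
      obtain rfl : k = k' := Fin.ext (by omega)
      obtain rfl := Fin.ext h3
      rfl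
  · intro e
    constructor
    · rintro ⟨⟨i, k⟩ | ⟨i, k, j⟩, rfl⟩ <;> dsimp only <;> omega
    · obtain ⟨t, h, a, ht, hh, hv⟩ := e
      dsimp only
      intro he
      have ht0 : t ≠ 0 := by
        rintro rfl
        simp only [List.getD_cons_zero] at hv
        omega
      obtain ⟨i, rfl⟩ := Nat.exists_eq_succ_of_ne_zero ht0
      have hi : i < l.length := by
        by_contra hi
        rw [Nat.succ_eq_add_one, List.getD_cons_succ, List.getD_eq_default _ _ (by omega)] at hv
        omega
      have hwi := hw ⟨i, hi⟩
      rw [Nat.succ_eq_add_one, hwi] at hv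
      by_cases hh0 : h = 0
      · subst hh0
        refine ⟨.inl ⟨⟨i, hi⟩, ⟨a - 1, ?_⟩⟩, ?_⟩
        · omega
        · ext <;> dsimp only
          omega
      · refine ⟨.inr ⟨⟨i, hi⟩, ⟨a - 1, ?_⟩, ⟨⟨h, hh⟩, ?_⟩⟩, ?_⟩
        · omega
        · dsimp only
          omega
        · ext <;> dsimp only
          omega
  · rintro (⟨i, k⟩ | ⟨i, k, j, hj⟩) x
    · simp [gainMatrix, partColumn, gainVec_head_zero]
    · simp [gainMatrix, partColumn, gainVec_of_ne_zero (Nat.succ_ne_zero i) hj.1]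

/-! ### Partitions and the main theorem -/

section Main

variable {Δ : ℕ} (p : Nat.Partition (Δ - 1))

theorem sum_sort_parts : (p.parts.sort (· ≥ ·)).sum = Δ - 1 := by
  rw [← Multiset.sum_coe, Multiset.sort_eq, p.parts_sum]

theorem length_sort_parts_le : (p.parts.sort (· ≥ ·)).length ≤ Δ - 1 := by
  have := Multiset.card_nsmul_le_sum (s := p.parts) (a := 1) (fun x hx => p.parts_pos hx)
  rw [p.parts_sum] at this
  simpa using this

theorem isSimpleModular_of_isomorphic_gainMatrix {α : Type*} {M : Matroid α} {r : ℕ} {l : List ℕ}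
    (hr : 0 < r) (h0 : 1 ≤ l.getD 0 0) (hl : l.length ≤ r) (hsum : l.sum = Δ)
    (h : Isomorphic M (vectorMatroid (gainMatrix r (fun v => l.getD v 0)))) :
    IsSimpleModular Δ r ((r + 1).choose 2 + (Δ - 1) * (r - 1)) M := by
  refine (isSimpleModular_gainMatrix hr (fun v => l.getD v 0) h0 ?_).of_isomorphic h
  have := sum_range_getD id rfl l r hl
  simpa [hsum] using this

theorem partition_eq_of_count_eq {n : ℕ} {p q : Nat.Partition n}
    (h : ∀ k, k ≠ 0 → p.parts.count k = q.parts.count k) : p = q := by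
  apply Nat.Partition.ext
  ext k
  by_cases hk : k = 0
  · subst hk
    rw [Multiset.count_eq_zero_of_notMem fun h0 => (p.parts_pos h0).ne rfl,
      Multiset.count_eq_zero_of_notMem fun h0 => (q.parts_pos h0).ne rfl]
  · exact h k hk

/-- Moves the matroids, whose column types differ, onto one ground type so that they form a single
family. -/
theorem exists_fin_model {m n : Type*} [Finite n] {Δ r s : ℕ} {A : Matrix m n ℤ}
    (h : IsSimpleModular Δ r s (vectorMatroid A)) :
    ∃ M : Matroid (Fin s), Isomorphic M (vectorMatroid A) := by
  have hcard := h.card_eq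
  rw [vectorMatroid_ground, Set.encard_univ, ENat.card_eq_coe_natCard] at hcard
  let e := Finite.equivFinOfCardEq (Nat.cast_injective hcard)
  exact ⟨vectorMatroid (A.submatrix id e.symm),
    isomorphic_of_columns _ _ e.symm fun c => Or.inl fun x => rfl⟩

end Main

end DeltaModular

theorem theorem2 (Δ r : ℕ) (hΔ : 2 ≤ Δ) (hr : 2 ≤ r) (hrΔ : Δ + 1 ≤ r) :
    (∃ M : Fin (Fintype.card (Nat.Partition (Δ - 1)) + 1) →
        Matroid (Fin ((r + 1).choose 2 + (Δ - 1) * (r - 1))),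
      (∀ i, DeltaModular.IsSimpleModular Δ r ((r + 1).choose 2 + (Δ - 1) * (r - 1)) (M i)) ∧
      (∀ i j, i ≠ j → ¬ DeltaModular.Isomorphic (M i) (M j))) ∧
    (∀ p : Nat.Partition (Δ - 1),
      DeltaModular.IsSimpleModular Δ r ((r + 1).choose 2 + (Δ - 1) * (r - 1))
        (DeltaModular.vectorMatroid (DeltaModular.partMatrix Δ p r))) ∧
    DeltaModular.IsSimpleModular Δ r ((r + 1).choose 2 + (Δ - 1) * (r - 1))
      (DeltaModular.vectorMatroid (DeltaModular.leeMatrix Δ r)) ∧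
    (∀ p q : Nat.Partition (Δ - 1), p ≠ q →
      ¬ DeltaModular.Isomorphic (DeltaModular.vectorMatroid (DeltaModular.partMatrix Δ p r))
        (DeltaModular.vectorMatroid (DeltaModular.partMatrix Δ q r))) ∧
    (∀ p : Nat.Partition (Δ - 1),
      ¬ DeltaModular.Isomorphic (DeltaModular.vectorMatroid (DeltaModular.partMatrix Δ p r))
        (DeltaModular.vectorMatroid (DeltaModular.leeMatrix Δ r))) := by
  open DeltaModular in
  -- At most Δ - 1 parts and the leading 1 give length at most Δ < r: here r ≥ Δ + 1 enters.
  have hlen : ∀ p : Nat.Partition (Δ - 1), (1 :: p.parts.sort (· ≥ ·)).length < r := fun p => by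
    have := length_sort_parts_le p
    rw [List.length_cons]
    omega
  have hsum : ∀ p : Nat.Partition (Δ - 1), (1 :: p.parts.sort (· ≥ ·)).sum = Δ := fun p => by
    rw [List.sum_cons, sum_sort_parts]
    omega
  have iso : ∀ p : Nat.Partition (Δ - 1), Isomorphic (vectorMatroid (partMatrix Δ p r))
      (vectorMatroid (gainMatrix r (fun v => (1 :: p.parts.sort (· ≥ ·)).getD v 0))) := fun p =>
    isomorphic_partColumn (hlen p)
  have isoLee := isomorphic_leeMatrix hΔ hr
  have part : ∀ p : Nat.Partition (Δ - 1), IsSimpleModular Δ r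
      ((r + 1).choose 2 + (Δ - 1) * (r - 1)) (vectorMatroid (partMatrix Δ p r)) := fun p =>
    isSimpleModular_of_isomorphic_gainMatrix (by omega) (by simp) (hlen p).le (hsum p) (iso p)
  have lee : IsSimpleModular Δ r ((r + 1).choose 2 + (Δ - 1) * (r - 1))
      (vectorMatroid (leeMatrix Δ r)) :=
    isSimpleModular_of_isomorphic_gainMatrix (l := [Δ]) (by omega) (by simp; omega)
      (by simp; omega) (by simp) isoLee
  have part_ne : ∀ p q : Nat.Partition (Δ - 1), p ≠ q →
      ¬ Isomorphic (vectorMatroid (partMatrix Δ p r)) (vectorMatroid (partMatrix Δ q r)) := by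
    intro p q hpq h
    refine hpq (partition_eq_of_count_eq fun k hk => ?_)
    have := count_eq_of_isomorphic_gainMatrix (hlen p) (hlen q) hr ((hsum p).trans (hsum q).symm)
      ((iso p).symm.trans (h.trans (iso q))) k hk
    rw [List.count_cons, List.count_cons, add_left_inj, ← Multiset.coe_count,
      ← Multiset.coe_count, Multiset.sort_eq, Multiset.sort_eq] at this
    exact this
  have part_lee : ∀ p : Nat.Partition (Δ - 1),
      ¬ Isomorphic (vectorMatroid (partMatrix Δ p r)) (vectorMatroid (leeMatrix Δ r)) := by
    intro p h
    -- The weight 1 separates the two: it occurs at vertex 0 on the partition side, but never in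
    -- `[Δ]` since Δ ≥ 2.
    have := count_eq_of_isomorphic_gainMatrix (l' := [Δ]) (hlen p) (by simp; omega) hr
      ((hsum p).trans (by simp)) ((iso p).symm.trans (h.trans isoLee)) 1 one_ne_zero
    have h0 : List.count 1 [Δ] = 0 := List.count_eq_zero_of_not_mem (by
      rw [List.mem_singleton]
      omega)
    rw [List.count_cons_self, h0] at this
    omega
  refine ⟨?_, part, lee, part_ne, part_lee⟩
  choose N hN using fun p => exists_fin_model (part p)
  obtain ⟨N', hN'⟩ := exists_fin_model lee
  -- `none` stands for A(Δ, r), the extra matroid beyond the partitions.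
  let e : Fin (Fintype.card (Nat.Partition (Δ - 1)) + 1) ≃ Option (Nat.Partition (Δ - 1)) :=
    (Fintype.equivFinOfCardEq (Fintype.card_option)).symm
  refine ⟨fun i => (e i).elim N' N, fun i => ?_, fun i j hij h => ?_⟩
  · dsimp only
    rcases e i with _ | p
    · exact lee.of_isomorphic hN'
    · exact (part p).of_isomorphic (hN p)
  · have hne := e.injective.ne hij
    revert h hne
    dsimp only
    rcases e i with _ | p <;> rcases e j with _ | q <;> intro h hne
    · exact hne rfl
    · exact part_lee q ((hN q).symm.trans (h.symm.trans hN'))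
    · exact part_lee p ((hN p).symm.trans (h.trans hN'))
    · exact part_ne p q (fun h0 => hne (congrArg some h0)) ((hN p).symm.trans (h.trans (hN q)))
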